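/- **Definitions.** Banach spaces are complex, with a given norm. A class $\mathcal E$ of Banach spaces is *of type $>1$* if there are $p>1$ and $T\ge 0$ such that for all $E\in\mathcal E$, $n\ge 1$ and $x_1,\dots,x_n\in E$, $$\Big(2^{-n}\sum_{\varepsilon\in\{\pm1\}^n}\big\|\sum_{i}\varepsilon_i x_i\big\|^2\Big)^{1/2}\le T\Big(\sum_i\|x_i\|^p\Big)^{1/p}.$$ It is stable under duality (resp. complex conjugation) if $E\in\mathcal E$ implies $E^*\in\mathcal E$ (resp. $\overline E\in\mathcal E$). Let $G$ be a locally compact (Hausdorff) group with left Haar measure $dg$. Let $\mathcal E_{G,0}$ be the class of pairs $(E,\pi)$ with $E\in\mathcal E$ and $\pi$ a strongly continuous representation of $G$ on $E$ with $\|\pi(g)\|\le 1$ for all $g\in G$ (so $\pi$ is isometric). For $f\in C_c(G)$ put $\pi(f)=\int_G f(g)\pi(g)\,dg$, and let $\mathcal C_0^{\mathcal E}(G)$ be the Banach algebra obtained by completing the convolution algebra $C_c(G)$ for $\|f\|=\sup_{(E,\pi)\in\mathcal E_{G,0}}\|\pi(f)\|$; each $\pi$ extends to it by continuity. Writing $e_g$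 for the Dirac mass at $g$, let $\bar f$ be the complex conjugate of $f$ and let $f^*=\int_G\overline{f(g)}\,e_{g^{-1}}\,dg$. An element $p\in\mathcal C_0^{\mathcal E}(G)$ is *real* (resp. *self-adjoint*) if it is fixed by the closed extension of $f\mapsto\bar f$ (resp. $f\mapsto f^*$), i.e. if $(p,p)$ lies in the closure of $\{(f,\bar f)\}$ (resp. $\{(f,f^*)\}$), $f\in C_c(G)$; when the operation is isometric this just says $\bar p=p$ (resp. $p^*=p$). $G$ has *Banach property (T)* if for every class $\mathcal E$ of type $>1$, stable under duality and complex conjugation, there is a real and self-adjoint idempotent $p\in\mathcal C_0^{\mathcal E}(G)$ such that for every $(E,\pi)\in\mathcal E_{G,0}$ the image of $\pi(p)$ is exactly the space $E^G$ of $G$-invariant vectors. **Proposition 5.6.** Let $G$ be a locally compact group and $\Gamma$ a discrete subgroup of $G$ with finite covolume, i.e. such that $G/\Gamma$ carries a nonzero finite $G$-invariant regular Borel measure ($\Gamma$ need not be cocompact). If $G$ has Banach property (T), then so does $\Gamma$. -/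

import Mathlib

open MeasureTheory UniformSpace Topology
open scoped CompactlySupported ComplexConjugate Pointwise

set_option linter.unusedSectionVars false

noncomputable section

namespace BanachT

/-! ### Complex conjugate of a Banach space -/

/-- The complex conjugate `Ē` of a complex normed space `E`: the same normed group, where the
scalar `c` acts as `conj c` acts on `E`. -/
def ConjSpace (E : Type*) : Type _ := E

namespace ConjSpace

instance {E : Type*} [h : NormedAddCommGroup E] : NormedAddCommGroup (ConjSpace E) := h

instance {E : Type*} [NormedAddCommGroup E] [h : CompleteSpace E] :
    CompleteSpace (ConjSpace E) := h

instance {E : Type*} [NormedAddCommGroup E] [h : NormedSpace ℂ E] : NormedSpace ℂ (ConjSpace E) where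
  smul c x := h.toModule.toDistribMulAction.toMulAction.toSMul.smul (conj c) x
  one_smul x := by
    change (conj (1 : ℂ)) • (show E from x) = x
    rw [map_one, one_smul]
  mul_smul a b x := by
    change (conj (a * b)) • (show E from x) = (conj a) • (conj b) • (show E from x)
    rw [map_mul, mul_smul]
  smul_zero a := by
    change (conj a) • (0 : E) = 0
    exact smul_zero _
  smul_add a x y := by
    change (conj a) • ((show E from x) + (show E from y)) = conj a • (show E from x) + conj a • (show E from y)
    exact smul_add _ _ _
  add_smul a b x := by
    change (conj (a + b)) • (show E from x) = conj a • (show E from x) + conj b • (show E from x)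
    rw [map_add, add_smul]
  zero_smul x := by
    change (conj (0 : ℂ)) • (show E from x) = (0 : E)
    rw [map_zero, zero_smul]
  norm_smul_le a x := by
    change ‖(conj a) • (show E from x)‖ ≤ ‖a‖ * ‖(show E from x)‖
    rw [norm_smul, RCLike.norm_conj]

end ConjSpace

/-! ### Classes of Banach spaces -/

/-- A class of complex Banach spaces (each with its given norm). -/
abbrev BanachClass.{w} : Type (w + 1) :=
  ∀ (E : Type w) [NormedAddCommGroup E] [NormedSpace ℂ E] [CompleteSpace E], Prop

/-- A class is (uniformly) of type `> 1`: there are `p > 1` and `T ≥ 0` such that every `E` in the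
class, every `n` and all `x₁, …, xₙ ∈ E` satisfy
`(𝔼_{ε = ± 1} ‖∑ εᵢ xᵢ‖²)^(1/2) ≤ T (∑ ‖xᵢ‖ᵖ)^(1/p)`; the signs range over `ℤˣ = {1, -1}`. -/
def BanachClass.IsOfTypeGTOne.{w} (𝓔 : BanachClass.{w}) : Prop :=
  ∃ p T : ℝ, 1 < p ∧ 0 ≤ T ∧
    ∀ (E : Type w) [NormedAddCommGroup E] [NormedSpace ℂ E] [CompleteSpace E], 𝓔 E →
      ∀ (n : ℕ) (x : Fin n → E),
        Real.sqrt ((∑ ε : Fin n → ℤˣ, ‖∑ i, ((ε i : ℤ) : ℂ) • x i‖ ^ 2) / 2 ^ n) ≤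
          T * (∑ i, ‖x i‖ ^ p) ^ (1 / p)

/-- `E ∈ 𝓔` implies `E* ∈ 𝓔`. -/
def BanachClass.IsStableUnderDuality.{w} (𝓔 : BanachClass.{w}) : Prop :=
  ∀ (E : Type w) [NormedAddCommGroup E] [NormedSpace ℂ E] [CompleteSpace E],
    𝓔 E → 𝓔 (StrongDual ℂ E)

/-- `E ∈ 𝓔` implies `Ē ∈ 𝓔`. -/
def BanachClass.IsStableUnderConj.{w} (𝓔 : BanachClass.{w}) : Prop :=
  ∀ (E : Type w) [NormedAddCommGroup E] [NormedSpace ℂ E] [CompleteSpace E],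
    𝓔 E → 𝓔 (ConjSpace E)

/-! ### Isometric representations and the operators `π(f)` -/

/-- A continuous isometric representation of `G` on `E`, that is a strongly continuous
representation with `‖π(g)‖ ≤ 1 = e⁰` for all `g`. -/
structure IsometricRep (G : Type*) [Group G] [TopologicalSpace G]
    (E : Type*) [NormedAddCommGroup E] [NormedSpace ℂ E] where
  /-- the underlying homomorphism -/
  toHom : G →* (E →L[ℂ] E)
  norm_le_one : ∀ g, ‖toHom g‖ ≤ 1
  continuous_apply : ∀ x : E, Continuous fun g => toHom g x

section

variable {G : Type*} [Group G] [TopologicalSpace G] [IsTopologicalGroup G]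
  [LocallyCompactSpace G] [MeasurableSpace G] [BorelSpace G]

section Rep

variable {E : Type*} [NormedAddCommGroup E] [NormedSpace ℂ E]

/-- The space `E^G` of invariant vectors. -/
def IsometricRep.invariants (π : IsometricRep G E) : Set E := {x | ∀ g, π.toHom g x = x}

lemma IsometricRep.norm_apply_le (π : IsometricRep G E) (g : G) (x : E) :
    ‖π.toHom g x‖ ≤ ‖x‖ := by
  simpa using (π.toHom g).le_of_opNorm_le (π.norm_le_one g) x

lemma IsometricRep.continuous_uncurry (π : IsometricRep G E) :
    Continuous fun q : G × E => π.toHom q.1 q.2 := by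
  refine continuous_iff_continuousAt.2 fun ⟨g, x⟩ => ?_
  rw [ContinuousAt, tendsto_iff_norm_sub_tendsto_zero]
  have h1 : Filter.Tendsto (fun q : G × E => ‖q.2 - x‖ + ‖π.toHom q.1 x - π.toHom g x‖)
      (𝓝 (g, x)) (𝓝 0) := by
    have : Continuous (fun q : G × E => ‖q.2 - x‖ + ‖π.toHom q.1 x - π.toHom g x‖) :=
      ((continuous_snd.sub continuous_const).norm).add
        ((((π.continuous_apply x).comp continuous_fst).sub continuous_const).norm)
    simpa using this.tendsto (g, x)
  refine squeeze_zero (fun _ => norm_nonneg _) (fun q => ?_) h1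
  calc ‖π.toHom q.1 q.2 - π.toHom g x‖
      = ‖π.toHom q.1 (q.2 - x) + (π.toHom q.1 x - π.toHom g x)‖ := by
        rw [map_sub]; congr 1; abel
    _ ≤ _ := (norm_add_le _ _).trans (by gcongr; exact π.norm_apply_le _ _)

lemma IsometricRep.continuous_smul_apply (π : IsometricRep G E) (f : C_c(G, ℂ)) (x : E) :
    Continuous fun g => f g • π.toHom g x :=
  f.continuous.smul (π.continuous_apply x)

lemma IsometricRep.integrable (μ : Measure G) [IsFiniteMeasureOnCompacts μ]
    (π : IsometricRep G E) (f : C_c(G, ℂ)) (x : E) :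
    Integrable (fun g => f g • π.toHom g x) μ :=
  (π.continuous_smul_apply f x).integrable_of_hasCompactSupport f.hasCompactSupport.smul_right

lemma integrable_norm_cc (μ : Measure G) [IsFiniteMeasureOnCompacts μ] (f : C_c(G, ℂ)) :
    Integrable (fun g => ‖f g‖) μ :=
  (f.continuous.integrable_of_hasCompactSupport f.hasCompactSupport).norm

lemma IsometricRep.norm_integral_le (μ : Measure G) [IsFiniteMeasureOnCompacts μ]
    (π : IsometricRep G E) (f : C_c(G, ℂ)) (x : E) :
    ‖∫ g, f g • π.toHom g x ∂μ‖ ≤ (∫ g, ‖f g‖ ∂μ) * ‖x‖ := by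
  rw [← integral_mul_const]
  refine norm_integral_le_of_norm_le ((integrable_norm_cc μ f).mul_const _) (.of_forall fun g => ?_)
  rw [norm_smul]
  gcongr
  exact π.norm_apply_le g x

/-- The operator `π(f) = ∫ f(g) π(g) dg` (a strong integral) for `f ∈ C_c(G)`. -/
def IsometricRep.integrate (μ : Measure G) [IsFiniteMeasureOnCompacts μ]
    (π : IsometricRep G E) (f : C_c(G, ℂ)) : E →L[ℂ] E :=
  LinearMap.mkContinuous
    { toFun := fun x => ∫ g, f g • π.toHom g x ∂μ
      map_add' := fun x y => by
        simp only [map_add, smul_add]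
        exact integral_add (π.integrable μ f x) (π.integrable μ f y)
      map_smul' := fun c x => by
        simp only [map_smul, RingHom.id_apply]
        rw [← integral_smul]
        simp only [smul_comm c] }
    (∫ g, ‖f g‖ ∂μ) (fun x => π.norm_integral_le μ f x)

lemma IsometricRep.integrate_apply (μ : Measure G) [IsFiniteMeasureOnCompacts μ]
    (π : IsometricRep G E) (f : C_c(G, ℂ)) (x : E) :
    π.integrate μ f x = ∫ g, f g • π.toHom g x ∂μ := rfl

lemma IsometricRep.norm_integrate_le (μ : Measure G) [IsFiniteMeasureOnCompacts μ]
    (π : IsometricRep G E) (f : C_c(G, ℂ)) : ‖π.integrate μ f‖ ≤ ∫ g, ‖f g‖ ∂μ :=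
  LinearMap.mkContinuous_norm_le _ (integral_nonneg fun _ => norm_nonneg _) _

lemma IsometricRep.integrate_add (μ : Measure G) [IsFiniteMeasureOnCompacts μ]
    (π : IsometricRep G E) (f f' : C_c(G, ℂ)) :
    π.integrate μ (f + f') = π.integrate μ f + π.integrate μ f' := by
  ext x
  simp only [integrate_apply, add_apply, CompactlySupportedContinuousMap.coe_add,
    Pi.add_apply, add_smul]
  exact integral_add (π.integrable μ f x) (π.integrable μ f' x)

lemma IsometricRep.integrate_smul (μ : Measure G) [IsFiniteMeasureOnCompacts μ]
    (π : IsometricRep G E) (c : ℂ) (f : C_c(G, ℂ)) :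
    π.integrate μ (c • f) = c • π.integrate μ f := by
  ext x
  simp only [integrate_apply, smul_apply,
    CompactlySupportedContinuousMap.coe_smul, Pi.smul_apply, smul_assoc]
  exact integral_smul _ _

end Rep

/-! ### Convolution, conjugation and involution on `C_c(G)` -/

lemma isCompact_tsupport_mul (f f' : C_c(G, ℂ)) :
    IsCompact (closure (tsupport f * tsupport f')) :=
  (f.hasCompactSupport.isCompact.mul f'.hasCompactSupport.isCompact).closure

lemma conv_integrand_eq_zero (f f' : C_c(G, ℂ)) (q : G × G)
    (h : q ∉ (tsupport f * tsupport f') ×ˢ tsupport f) : f q.2 * f' (q.2⁻¹ * q.1) = 0 := by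
  by_contra h0
  have h1 : q.2 ∈ tsupport f := subset_tsupport _ (left_ne_zero_of_mul h0)
  have h2 : q.2⁻¹ * q.1 ∈ tsupport f' := subset_tsupport _ (right_ne_zero_of_mul h0)
  exact h ⟨⟨q.2, h1, q.2⁻¹ * q.1, h2, by simp⟩, h1⟩

lemma continuous_conv_integrand (f f' : C_c(G, ℂ)) :
    Continuous fun q : G × G => f q.2 * f' (q.2⁻¹ * q.1) :=
  (f.continuous.comp continuous_snd).mul
    (f'.continuous.comp (continuous_snd.inv.mul continuous_fst))

/-- The convolution `(f * f')(x) = ∫ f(y) f'(y⁻¹x) dy`, which is the product for which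
`f = ∫ f(g) e_g dg` with `e_g e_h = e_{gh}`. -/
def conv (μ : Measure G) [IsFiniteMeasureOnCompacts μ] (f f' : C_c(G, ℂ)) : C_c(G, ℂ) where
  toFun x := ∫ y, f y * f' (y⁻¹ * x) ∂μ
  continuous_toFun := by
    rw [← continuousOn_univ]
    refine continuousOn_integral_of_compact_support f.hasCompactSupport.isCompact
      (continuous_conv_integrand f f').continuousOn fun x y _ hy => ?_
    rw [image_eq_zero_of_notMem_tsupport hy, zero_mul]
  hasCompactSupport' := by
    refine HasCompactSupport.intro' (isCompact_tsupport_mul f f') isClosed_closure fun x hx => ?_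
    have : ∀ y, f y * f' (y⁻¹ * x) = 0 := fun y =>
      conv_integrand_eq_zero f f' (x, y) fun h => hx (subset_closure h.1)
    simp [this]

lemma conv_apply (μ : Measure G) [IsFiniteMeasureOnCompacts μ] (f f' : C_c(G, ℂ)) (x : G) :
    conv μ f f' x = ∫ y, f y * f' (y⁻¹ * x) ∂μ := rfl

/-- `π(f * f') = π(f) π(f')`. -/
lemma IsometricRep.integrate_conv (μ : Measure G) [IsFiniteMeasureOnCompacts μ]
    [μ.IsMulLeftInvariant] {E : Type*} [NormedAddCommGroup E] [NormedSpace ℂ E] [CompleteSpace E]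
    (π : IsometricRep G E) (f f' : C_c(G, ℂ)) :
    π.integrate μ (conv μ f f') = π.integrate μ f ∘L π.integrate μ f' := by
  ext v
  simp only [ContinuousLinearMap.comp_apply, integrate_apply, conv_apply]
  calc ∫ x, (∫ y, f y * f' (y⁻¹ * x) ∂μ) • π.toHom x v ∂μ
      = ∫ x, ∫ y, (f y * f' (y⁻¹ * x)) • π.toHom x v ∂μ ∂μ := by
        simp only [integral_smul_const]
    _ = ∫ y, ∫ x, (f y * f' (y⁻¹ * x)) • π.toHom x v ∂μ ∂μ := by
        refine integral_integral_swap_of_hasCompactSupport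
          ((continuous_conv_integrand f f').smul ((π.continuous_apply v).comp continuous_fst)) ?_
        refine HasCompactSupport.intro' ((isCompact_tsupport_mul f f').prod
          f.hasCompactSupport.isCompact) (isClosed_closure.prod (isClosed_tsupport _)) fun q hq => ?_
        have := conv_integrand_eq_zero f f' q fun h => hq ⟨subset_closure h.1, h.2⟩
        simp [Function.uncurry, this]
    _ = ∫ y, f y • π.toHom y (∫ z, f' z • π.toHom z v ∂μ) ∂μ := by
        congr 1 with y
        rw [← integral_mul_left_eq_self _ y, ← ContinuousLinearMap.integral_comp_comm _
          (π.integrable μ f' v), ← integral_smul]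
        congr 1 with z
        simp [mul_smul]

lemma integrable_conv_integrand (μ : Measure G) [IsFiniteMeasureOnCompacts μ] (f f' : C_c(G, ℂ))
    (x : G) : Integrable (fun y => f y * f' (y⁻¹ * x)) μ :=
  ((continuous_conv_integrand f f').comp
    (continuous_const.prodMk continuous_id)).integrable_of_hasCompactSupport
    (f.hasCompactSupport.mul_right (f' := fun y => f' (y⁻¹ * x)))

lemma conv_add_left (μ : Measure G) [IsFiniteMeasureOnCompacts μ] (f₁ f₂ f' : C_c(G, ℂ)) (x : G) :
    conv μ (f₁ + f₂) f' x = (conv μ f₁ f' + conv μ f₂ f') x := by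
  simp only [conv_apply, CompactlySupportedContinuousMap.add_apply, add_mul]
  exact integral_add (integrable_conv_integrand μ f₁ f' x) (integrable_conv_integrand μ f₂ f' x)

lemma conv_add_right (μ : Measure G) [IsFiniteMeasureOnCompacts μ] (f f₁ f₂ : C_c(G, ℂ)) (x : G) :
    conv μ f (f₁ + f₂) x = (conv μ f f₁ + conv μ f f₂) x := by
  simp only [conv_apply, CompactlySupportedContinuousMap.add_apply, mul_add]
  exact integral_add (integrable_conv_integrand μ f f₁ x) (integrable_conv_integrand μ f f₂ x)

lemma conv_smul_left (μ : Measure G) [IsFiniteMeasureOnCompacts μ] (c : ℂ) (f f' : C_c(G, ℂ))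
    (x : G) : conv μ (c • f) f' x = (c • conv μ f f') x := by
  simp only [conv_apply, CompactlySupportedContinuousMap.smul_apply, smul_eq_mul, mul_assoc]
  exact integral_const_mul _ _

lemma conv_smul_right (μ : Measure G) [IsFiniteMeasureOnCompacts μ] (c : ℂ) (f f' : C_c(G, ℂ))
    (x : G) : conv μ f (c • f') x = (c • conv μ f f') x := by
  simp only [conv_apply, CompactlySupportedContinuousMap.smul_apply, smul_eq_mul,
    mul_left_comm _ c]
  exact integral_const_mul _ _

/-- Complex conjugation `∫ f(g) e_g dg ↦ ∫ conj(f(g)) e_g dg` on `C_c(G)`. -/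
def ccConj (f : C_c(G, ℂ)) : C_c(G, ℂ) := star f

lemma integral_mul_right_eq_modular (μ : Measure G) [μ.IsHaarMeasure] {φ : G → ℝ}
    (hφ : Continuous φ) (h'φ : HasCompactSupport φ) (g : G) :
    ∫ x, φ (x * g) ∂μ = (Measure.modularCharacterFun g : ℝ) * ∫ x, φ x ∂μ := by
  have h := Measure.integral_isMulLeftInvariant_eq_smul_of_hasCompactSupport (μ.map (· * g)) μ
    hφ h'φ
  rw [Measure.modularCharacterFun_eq_haarScalarFactor μ g]
  have h2 : ∫ x, φ x ∂(μ.map (· * g)) = ∫ x, φ (x * g) ∂μ :=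
    (Homeomorph.mulRight g).measurableEmbedding.integral_map _
  rw [← h2, h, integral_smul_nnreal_measure, NNReal.smul_def, smul_eq_mul]

lemma continuous_modular : Continuous fun g : G => (Measure.modularCharacterFun g : ℝ) := by
  let μ : Measure G := Measure.haar
  obtain ⟨φ, hφ, hφ0, hφ1⟩ : ∃ f : C(G, ℝ), HasCompactSupport f ∧ 0 ≤ f ∧ f 1 ≠ 0 :=
    exists_continuous_nonneg_pos 1
  have hpos : 0 < ∫ x, φ x ∂μ :=
    φ.continuous.integral_pos_of_hasCompactSupport_nonneg_nonzero hφ hφ0 hφ1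
  have hc : Continuous fun g : G => ∫ x, φ (x * g) ∂μ := by
    refine continuous_iff_continuousAt.2 fun g₀ => ?_
    obtain ⟨t, t_comp, ht⟩ : ∃ t, IsCompact t ∧ t ∈ 𝓝 g₀ := exists_compact_mem_nhds g₀
    refine ContinuousOn.continuousAt (s := t) ?_ ht
    refine continuousOn_integral_of_compact_support (hφ.isCompact.mul t_comp.inv)
      (φ.continuous.comp (continuous_snd.mul continuous_fst)).continuousOn fun g x hg hx => ?_
    by_contra h0
    exact hx ⟨x * g, subset_tsupport _ h0, g⁻¹, by simpa using hg, by simp⟩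
  have : (fun g : G => (Measure.modularCharacterFun g : ℝ)) =
      fun g => (∫ x, φ (x * g) ∂μ) / ∫ x, φ x ∂μ := by
    ext g
    rw [integral_mul_right_eq_modular μ φ.continuous hφ, mul_div_cancel_right₀ _ hpos.ne']
  rw [this]
  exact hc.div_const _

/-- The usual involution on `C_c(G)`: `f*(g) = Δ(g) conj(f(g⁻¹))`, where `Δ` is the modular
function normalized by `∫ φ(xg) dx = Δ(g) ∫ φ(x) dx`. In other words `f*` is
`∫ conj(f(g)) e_{g⁻¹} dg`, see `integrate_ccStar`. -/
def ccStar (f : C_c(G, ℂ)) : C_c(G, ℂ) where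
  toFun g := ((Measure.modularCharacterFun g : ℝ) : ℂ) * conj (f g⁻¹)
  continuous_toFun := (Complex.continuous_ofReal.comp continuous_modular).mul
    (Complex.continuous_conj.comp (f.continuous.comp continuous_inv))
  hasCompactSupport' := by
    have h : HasCompactSupport fun g : G => f g⁻¹ :=
      f.hasCompactSupport.comp_homeomorph (Homeomorph.inv G)
    exact (h.comp_left (g := conj) (map_zero _)).mul_left

lemma integral_inv_eq_modular_real (μ : Measure G) [μ.IsHaarMeasure] {φ : G → ℝ}
    (hφ : Continuous φ) (h'φ : HasCompactSupport φ) :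
    ∫ x, (Measure.modularCharacterFun x : ℝ) * φ x ∂μ = ∫ x, φ x⁻¹ ∂μ := by
  obtain ⟨ψ, hψ, hψ0, hψ1⟩ : ∃ f : C(G, ℝ), HasCompactSupport f ∧ 0 ≤ f ∧ f 1 ≠ 0 :=
    exists_continuous_nonneg_pos 1
  have hpos : 0 < ∫ x, ψ x ∂μ :=
    ψ.continuous.integral_pos_of_hasCompactSupport_nonneg_nonzero hψ hψ0 hψ1
  have hinv : ∀ F : G → ℝ, ∫ x, F x ∂μ.inv = ∫ x, F x⁻¹ ∂μ := fun F =>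
    (Homeomorph.inv G).measurableEmbedding.integral_map _
  have := Measure.integral_isMulLeftInvariant_isMulRightInvariant_combo (μ := μ) (ν := μ.inv)
    (continuous_modular.mul hφ) h'φ.mul_left ψ.continuous hψ hψ0 hψ1
  simp only [Pi.mul_apply] at this
  rw [this, hinv, ← integral_mul_const]
  congr 1 with y
  rw [hinv]
  simp only [inv_inv]
  rw [integral_mul_right_eq_modular μ ψ.continuous hψ]
  have hy : (Measure.modularCharacterFun y⁻¹ : ℝ) ≠ 0 :=
    (NNReal.coe_pos.2 (Measure.modularCharacterFun_pos _)).ne'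
  field_simp

lemma integral_inv_eq_modular (μ : Measure G) [μ.IsHaarMeasure]
    {E : Type*} [NormedAddCommGroup E] [NormedSpace ℝ E] [CompleteSpace E] {φ : G → E}
    (hφ : Continuous φ) (h'φ : HasCompactSupport φ) :
    ∫ x, (Measure.modularCharacterFun x : ℝ) • φ x ∂μ = ∫ x, φ x⁻¹ ∂μ := by
  refine (SeparatingDual.eq_iff_forall_dual_eq (R := ℝ)).2 fun L => ?_
  have hi : Integrable (fun x => (Measure.modularCharacterFun x : ℝ) • φ x) μ :=
    (continuous_modular.smul hφ).integrable_of_hasCompactSupport h'φ.smul_left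
  have hi' : Integrable (fun x => φ x⁻¹) μ :=
    (hφ.comp continuous_inv).integrable_of_hasCompactSupport
      (h'φ.comp_homeomorph (Homeomorph.inv G))
  rw [← ContinuousLinearMap.integral_comp_comm L hi, ← ContinuousLinearMap.integral_comp_comm L hi']
  simpa using integral_inv_eq_modular_real μ (L.continuous.comp hφ) (h'φ.comp_left (map_zero L))

/-- `π(f*) = ∫ conj(f(g)) π(g⁻¹) dg`. -/
lemma IsometricRep.integrate_ccStar (μ : Measure G) [μ.IsHaarMeasure]
    {E : Type*} [NormedAddCommGroup E] [NormedSpace ℂ E] [CompleteSpace E]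
    (π : IsometricRep G E) (f : C_c(G, ℂ)) (v : E) :
    π.integrate μ (ccStar f) v = ∫ g, conj (f g) • π.toHom g⁻¹ v ∂μ := by
  have h1 : HasCompactSupport fun g : G => f g⁻¹ :=
    f.hasCompactSupport.comp_homeomorph (Homeomorph.inv G)
  have h2 : HasCompactSupport fun g : G => conj (f g⁻¹) • π.toHom g v :=
    (h1.comp_left (g := conj) (map_zero _)).smul_right
  have := integral_inv_eq_modular μ (φ := fun g : G => conj (f g⁻¹) • π.toHom g v)
    ((Complex.continuous_conj.comp (f.continuous.comp continuous_inv)).smul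
      (π.continuous_apply v)) h2
  simp only [inv_inv] at this
  rw [← this, integrate_apply]
  congr 1 with g
  rw [← Complex.coe_smul, smul_smul]
  rfl

/-! ### The Banach algebra `C_0^𝓔(G)` -/

/-- The values `‖π(f)‖`, where `(E, π)` runs over the class `𝓔_{G,0}` of continuous isometric
representations of `G` on spaces of `𝓔`. -/
def repNorms.{w} (𝓔 : BanachClass.{w}) (μ : Measure G) [IsFiniteMeasureOnCompacts μ]
    (f : C_c(G, ℂ)) : Set ℝ :=
  {r | ∃ (E : Type w) (_ : NormedAddCommGroup E) (_ : NormedSpace ℂ E) (_ : CompleteSpace E)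
    (_ : 𝓔 E) (π : IsometricRep G E), r = ‖π.integrate μ f‖}

section Norm

universe w

variable (𝓔 : BanachClass.{w}) (μ : Measure G)

lemma bddAbove_repNorms [IsFiniteMeasureOnCompacts μ] (f : C_c(G, ℂ)) :
    BddAbove (repNorms 𝓔 μ f) := by
  refine ⟨∫ g, ‖f g‖ ∂μ, ?_⟩
  rintro _ ⟨E, _, _, _, _, π, rfl⟩
  exact π.norm_integrate_le μ f

lemma norm_integrate_le_sSup [IsFiniteMeasureOnCompacts μ] {E : Type w} [NormedAddCommGroup E]
    [NormedSpace ℂ E] [CompleteSpace E] (hE : 𝓔 E) (π : IsometricRep G E) (f : C_c(G, ℂ)) :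
    ‖π.integrate μ f‖ ≤ sSup (repNorms 𝓔 μ f) :=
  le_csSup (bddAbove_repNorms 𝓔 μ f) ⟨E, _, _, _, hE, π, rfl⟩

lemma sSup_repNorms_nonneg [IsFiniteMeasureOnCompacts μ] (f : C_c(G, ℂ)) :
    0 ≤ sSup (repNorms 𝓔 μ f) := by
  refine Real.sSup_nonneg ?_
  rintro _ ⟨E, _, _, _, _, π, rfl⟩
  exact norm_nonneg _

/-- The seminorm `‖f‖ = sup_{(E, π) ∈ 𝓔_{G,0}} ‖π(f)‖` on `C_c(G)`. -/
def repSeminorm [IsFiniteMeasureOnCompacts μ] : Seminorm ℂ C_c(G, ℂ) :=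
  Seminorm.ofSMulLE (fun f => sSup (repNorms 𝓔 μ f))
    (le_antisymm (Real.sSup_le (by
      rintro _ ⟨E, _, _, _, _, π, rfl⟩
      simpa using π.norm_integrate_le μ 0) le_rfl) (sSup_repNorms_nonneg 𝓔 μ 0))
    (fun f f' => Real.sSup_le (by
      rintro _ ⟨E, _, _, _, hE, π, rfl⟩
      rw [π.integrate_add μ]
      exact (norm_add_le _ _).trans (add_le_add (norm_integrate_le_sSup 𝓔 μ hE π f)
        (norm_integrate_le_sSup 𝓔 μ hE π f')))
      (add_nonneg (sSup_repNorms_nonneg 𝓔 μ f) (sSup_repNorms_nonneg 𝓔 μ f')))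
    (fun c f => Real.sSup_le (by
      rintro _ ⟨E, _, _, _, hE, π, rfl⟩
      rw [π.integrate_smul μ, norm_smul]
      exact mul_le_mul_of_nonneg_left (norm_integrate_le_sSup 𝓔 μ hE π f) (norm_nonneg _))
      (mul_nonneg (norm_nonneg _) (sSup_repNorms_nonneg 𝓔 μ f)))

/-- `C_c(G)` as a seminormed space for the seminorm `repSeminorm`. -/
def CcAlg [IsFiniteMeasureOnCompacts μ] : Type _ :=
  let _ := 𝓔
  let _ := μ
  C_c(G, ℂ)

variable [IsFiniteMeasureOnCompacts μ]

/-- `f ∈ C_c(G)` as an element of the seminormed space `CcAlg 𝓔 μ`. -/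
def toCcAlg (f : C_c(G, ℂ)) : CcAlg 𝓔 μ := f

instance : AddCommGroup (CcAlg 𝓔 μ) := inferInstanceAs (AddCommGroup C_c(G, ℂ))

instance : Module ℂ (CcAlg 𝓔 μ) := inferInstanceAs (Module ℂ C_c(G, ℂ))

instance : SeminormedAddCommGroup (CcAlg 𝓔 μ) :=
  AddGroupSeminorm.toSeminormedAddCommGroup (E := CcAlg 𝓔 μ)
    (Seminorm.toAddGroupSeminorm (repSeminorm 𝓔 μ))

lemma norm_toCcAlg (f : C_c(G, ℂ)) : ‖toCcAlg 𝓔 μ f‖ = sSup (repNorms 𝓔 μ f) := rfl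

instance : NormedSpace ℂ (CcAlg 𝓔 μ) where
  norm_smul_le c f := (map_smul_eq_mul (repSeminorm 𝓔 μ) c f).le

lemma norm_conv_le [μ.IsMulLeftInvariant] (f f' : C_c(G, ℂ)) :
    ‖toCcAlg 𝓔 μ (conv μ f f')‖ ≤ ‖toCcAlg 𝓔 μ f‖ * ‖toCcAlg 𝓔 μ f'‖ := by
  simp only [norm_toCcAlg]
  refine Real.sSup_le ?_ (mul_nonneg (sSup_repNorms_nonneg 𝓔 μ f) (sSup_repNorms_nonneg 𝓔 μ f'))
  rintro _ ⟨E, _, _, _, hE, π, rfl⟩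
  rw [π.integrate_conv μ]
  exact (ContinuousLinearMap.opNorm_comp_le _ _).trans (mul_le_mul
    (norm_integrate_le_sSup 𝓔 μ hE π f) (norm_integrate_le_sSup 𝓔 μ hE π f') (norm_nonneg _)
    (sSup_repNorms_nonneg 𝓔 μ f))

/-- Convolution as a bounded bilinear map on the seminormed space `C_c(G)`. -/
def convL [μ.IsMulLeftInvariant] : CcAlg 𝓔 μ →L[ℂ] CcAlg 𝓔 μ →L[ℂ] CcAlg 𝓔 μ :=
  LinearMap.mkContinuous₂
    (LinearMap.mk₂ ℂ (fun f f' : CcAlg 𝓔 μ => toCcAlg 𝓔 μ (conv μ f f'))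
      (fun f₁ f₂ f' => DFunLike.ext (F := C_c(G, ℂ)) _ _ (conv_add_left μ f₁ f₂ f'))
      (fun c f f' => DFunLike.ext (F := C_c(G, ℂ)) _ _ (conv_smul_left μ c f f'))
      (fun f f₁ f₂ => DFunLike.ext (F := C_c(G, ℂ)) _ _ (conv_add_right μ f f₁ f₂))
      (fun c f f' => DFunLike.ext (F := C_c(G, ℂ)) _ _ (conv_smul_right μ c f f')))
    1 (fun f f' => by
      rw [one_mul]
      exact norm_conv_le 𝓔 μ f f')

/-- The Banach algebra `C_0^𝓔(G)`: the completion of `C_c(G)` for the norm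
`‖f‖ = sup_{(E, π) ∈ 𝓔_{G,0}} ‖π(f)‖`. -/
abbrev CAlg : Type _ := Completion (CcAlg 𝓔 μ)

/-- The image of `f ∈ C_c(G)` in `C_0^𝓔(G)`. -/
def ofCc (f : C_c(G, ℂ)) : CAlg 𝓔 μ := (toCcAlg 𝓔 μ f : Completion (CcAlg 𝓔 μ))

lemma denseRange_toComplL : DenseRange (Completion.toComplL (𝕜 := ℂ) (E := CcAlg 𝓔 μ)) :=
  Completion.denseRange_coe

lemma isUniformInducing_toComplL :
    IsUniformInducing (Completion.toComplL (𝕜 := ℂ) (E := CcAlg 𝓔 μ)) :=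
  Completion.isUniformInducing_coe _

/-- The extension by continuity of the convolution product to `C_0^𝓔(G)`. -/
def mulL [μ.IsMulLeftInvariant] : CAlg 𝓔 μ →L[ℂ] CAlg 𝓔 μ →L[ℂ] CAlg 𝓔 μ :=
  (((((ContinuousLinearMap.compL ℂ (CcAlg 𝓔 μ) (CcAlg 𝓔 μ) (CAlg 𝓔 μ)
    Completion.toComplL) ∘L convL 𝓔 μ).extend Completion.toComplL).flip).extend
      Completion.toComplL).flip

instance [μ.IsMulLeftInvariant] : Mul (CAlg 𝓔 μ) := ⟨fun p q => mulL 𝓔 μ p q⟩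

lemma ofCc_mul_ofCc [μ.IsMulLeftInvariant] (f f' : C_c(G, ℂ)) :
    ofCc 𝓔 μ f * ofCc 𝓔 μ f' = ofCc 𝓔 μ (conv μ f f') := by
  change mulL 𝓔 μ (Completion.toComplL (𝕜 := ℂ) (toCcAlg 𝓔 μ f))
    (Completion.toComplL (𝕜 := ℂ) (toCcAlg 𝓔 μ f')) = _
  rw [mulL, ContinuousLinearMap.flip_apply, ContinuousLinearMap.extend_eq _
    (denseRange_toComplL 𝓔 μ) (isUniformInducing_toComplL 𝓔 μ), ContinuousLinearMap.flip_apply,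
    ContinuousLinearMap.extend_eq _ (denseRange_toComplL 𝓔 μ) (isUniformInducing_toComplL 𝓔 μ)]
  rfl

/-- `p` is fixed by the closed extension to `C_0^𝓔(G)` of a map `σ` of `C_c(G)`: the pair `(p, p)`
is a limit of pairs `(f, σ(f))` with `f ∈ C_c(G)`. If `σ` is isometric then this says `σ̂(p) = p`
for the extension `σ̂` of `σ` by continuity, see `isFixedByExtension_iff`. -/
def IsFixedByExtension (σ : C_c(G, ℂ) → C_c(G, ℂ)) (p : CAlg 𝓔 μ) : Prop :=
  (p, p) ∈ closure (Set.range fun f : C_c(G, ℂ) => (ofCc 𝓔 μ f, ofCc 𝓔 μ (σ f)))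

lemma isFixedByExtension_iff (σ : C_c(G, ℂ) → C_c(G, ℂ))
    (hσ : Isometry (fun f : CcAlg 𝓔 μ => toCcAlg 𝓔 μ (σ f))) (p : CAlg 𝓔 μ) :
    IsFixedByExtension 𝓔 μ σ p ↔
      Completion.map (fun f : CcAlg 𝓔 μ => toCcAlg 𝓔 μ (σ f)) p = p := by
  set s : CcAlg 𝓔 μ → CcAlg 𝓔 μ := fun f => toCcAlg 𝓔 μ (σ f)
  have hs := hσ.uniformContinuous
  have hr : ∀ f : C_c(G, ℂ), Completion.map s (ofCc 𝓔 μ f) = ofCc 𝓔 μ (σ f) := fun f =>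
    Completion.map_coe hs _
  have hc : Continuous (Completion.map s) := Completion.continuous_map
  constructor
  · intro h
    have hcl : IsClosed {q : CAlg 𝓔 μ × CAlg 𝓔 μ | Completion.map s q.1 = q.2} :=
      isClosed_eq (hc.comp continuous_fst) continuous_snd
    refine closure_minimal ?_ hcl h
    rintro _ ⟨f, rfl⟩
    exact hr f
  · intro h
    have h1 : p ∈ closure (Set.range (ofCc 𝓔 μ)) :=
      Completion.denseRange_coe (α := CcAlg 𝓔 μ) p
    have h2 := mem_closure_image (f := fun q => (q, Completion.map s q))
      (continuous_id.prodMk hc).continuousAt h1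
    simp only [h] at h2
    refine closure_mono ?_ h2
    rintro _ ⟨_, ⟨f, rfl⟩, rfl⟩
    exact ⟨f, by simp only [hr]⟩

/-- `p ∈ C_0^𝓔(G)` is real, i.e. fixed by complex conjugation. -/
def IsReal (p : CAlg 𝓔 μ) : Prop := IsFixedByExtension 𝓔 μ ccConj p

/-- `p ∈ C_0^𝓔(G)` is self-adjoint, i.e. fixed by the usual involution. -/
def IsSelfAdj (p : CAlg 𝓔 μ) : Prop := IsFixedByExtension 𝓔 μ ccStar p

variable {𝓔}

/-- The contraction `f ↦ π(f)`, for `(E, π) ∈ 𝓔_{G,0}`. -/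
def integrateL {E : Type w} [NormedAddCommGroup E] [NormedSpace ℂ E] [CompleteSpace E]
    (hE : 𝓔 E) (π : IsometricRep G E) : CcAlg 𝓔 μ →L[ℂ] (E →L[ℂ] E) :=
  LinearMap.mkContinuous
    { toFun := fun f : CcAlg 𝓔 μ => π.integrate μ f
      map_add' := π.integrate_add μ
      map_smul' := π.integrate_smul μ }
    1 (fun f => by
      rw [one_mul]
      exact norm_integrate_le_sSup 𝓔 μ hE π f)

/-- The operator `π(p)` for `p ∈ C_0^𝓔(G)` and `(E, π) ∈ 𝓔_{G,0}`: the extension by continuity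
of `f ↦ π(f)`. -/
def repOp {E : Type w} [NormedAddCommGroup E] [NormedSpace ℂ E] [CompleteSpace E]
    (hE : 𝓔 E) (π : IsometricRep G E) : CAlg 𝓔 μ →L[ℂ] (E →L[ℂ] E) :=
  (integrateL μ hE π).extend Completion.toComplL

lemma repOp_ofCc {E : Type w} [NormedAddCommGroup E] [NormedSpace ℂ E] [CompleteSpace E]
    (hE : 𝓔 E) (π : IsometricRep G E) (f : C_c(G, ℂ)) :
    repOp μ hE π (ofCc 𝓔 μ f) = π.integrate μ f :=
  ContinuousLinearMap.extend_eq _ (denseRange_toComplL 𝓔 μ) (isUniformInducing_toComplL 𝓔 μ) _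

end Norm

end

/-! ### Banach property (T) and lattices -/

/-- `G` has Banach property (T): for every class `𝓔` of type `> 1`, stable under duality and complex
conjugation, there is a real self-adjoint idempotent `p ∈ C_0^𝓔(G)` such that for every
`(E, π) ∈ 𝓔_{G,0}` the image of `π(p)` is exactly the space of `G`-invariant vectors.
This is asked for every left Haar measure on `G`; rescaling the Haar measure replaces `C_0^𝓔(G)` by
an isomorphic algebra, so the choice is immaterial. -/
def BanachPropertyT.{v, w} (G : Type v) [Group G] [TopologicalSpace G] [IsTopologicalGroup G]
    [LocallyCompactSpace G] [MeasurableSpace G] [BorelSpace G] : Prop :=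
  ∀ 𝓔 : BanachClass.{w}, 𝓔.IsOfTypeGTOne → 𝓔.IsStableUnderDuality → 𝓔.IsStableUnderConj →
    ∀ (μ : Measure G) [μ.IsHaarMeasure],
      ∃ p : CAlg 𝓔 μ, IsIdempotentElem p ∧ IsReal 𝓔 μ p ∧ IsSelfAdj 𝓔 μ p ∧
        ∀ (E : Type w) [NormedAddCommGroup E] [NormedSpace ℂ E] [CompleteSpace E] (hE : 𝓔 E)
          (π : IsometricRep G E), Set.range (repOp μ hE π p) = π.invariants

/-- `Γ` has finite covolume in `G`: the homogeneous space `G ⧸ Γ` of left cosets `gΓ` carries a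
nonzero finite regular Borel measure invariant under left translations by `G`. -/
def HasFiniteCovolume {G : Type*} [Group G] [TopologicalSpace G] [IsTopologicalGroup G]
    (Γ : Subgroup G) : Prop :=
  letI : MeasurableSpace (G ⧸ Γ) := borel (G ⧸ Γ)
  ∃ ν : Measure (G ⧸ Γ), ν ≠ 0 ∧ IsFiniteMeasure ν ∧ ν.Regular ∧ SMulInvariantMeasure G (G ⧸ Γ) ν

end BanachT

end

universe u v

/-!
Let `(E, π)` be an isometric representation of `Γ` on a space of `𝓔`. Inducing it to `G` gives an
isometric representation on a space of `L²` sections over `G ⧸ Γ`. Fix `φ ≥ 0` in `C_c(G)`, not zero.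
The map `J v = ∑_γ φ(· γ) π(γ) v` embeds `E` into the induced space, the average
`Q F = ∫ φ(g) F(g) dg` goes back, and for `f ∈ C_c(G)` the compression `Q ∘ Ind π(f) ∘ J` is
`π(T f)`, up to a scalar, for an explicit finitely supported `T f` on `Γ` (`integrate_transfer`).
Since `φ` does not depend on `π`, the map `T` is bounded for the norms of the two algebras
(`norm_transfer_le`). The projection for `Γ` is the image under `T` of the projection `p` for `G`.

* *The class for `G`.* The class `𝓔` need not contain the induced spaces, so property (T) of `G` is
  applied to the class `typeClass p T` of all spaces which satisfy the type `p` inequality together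
  with the inequality, stated inside the space, which is equivalent to the type `p` inequality for
  its dual. These two inequalities are exchanged by duality, with no appeal to reflexivity or
  `K`-convexity, and both pass to `L²` sections by Minkowski's inequality in `L^{2/p}`
  (`HasType.of_ltwo`, `HasDualType.of_ltwo`). In particular the dual of an `L²` space of sections
  never has to be computed.
* *Haar measure.* A left-invariant vector-valued Radon measure on `G` is a vector multiple of Haar
  measure (`IsLocallySupBounded.exists_eq_smul`). For scalars this gives Weil's formula
  `∫_G f = ∫_{G ⧸ Γ} ∑_γ f(gγ)`, hence the right `Γ`-invariance of Haar measure. For the measure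
  `ψ ↦ ∫ ψ(g) F(g) dg` attached to an invariant vector `F` of an induced representation it says that
  `F` is a constant section with value in `E^Γ` (`exists_average_eq_smul`).
* *The image.* Since `p J v` is invariant, `π(T p) v` lies in `E^Γ`. For `v ∈ E^Γ` the constant value
  of `p J v` is found by integrating over all of `G ⧸ Γ`, which is where the finiteness of the volume
  matters: approximating `p` by `f ∈ C_c(G)`, the sections involved have compact support modulo `Γ`,
  where the constant `1` is a sum `∑_γ ψ(gγ)`, and `∫ f → 1` because `p` acts as the identity in
  trivial representations (`vol_smul_eq_integral_smul`). So a suitable multiple of `T p` acts as a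
  projection onto `E^Γ` for every `(E, π)`, and it is idempotent since an element of the completed
  algebra is determined by its actions (`eq_of_repOp_eq`).
* *Symmetry.* The map `T` commutes with conjugation because `φ` is real, and with the involution
  because the same `φ` occurs in `J` and in `Q`.
-/

namespace BanachT

/-! ### The type inequality and its dual form -/

/-- The type `p` inequality with constant `T`. The signs act through the underlying group, so that
the condition does not see the scalar field. -/
def HasType (p T : ℝ) (E : Type*) [SeminormedAddCommGroup E] : Prop :=
  ∀ (n : ℕ) (x : Fin n → E),
    √((∑ ε : Fin n → ℤˣ, ‖∑ i, (ε i : ℤ) • x i‖ ^ 2) / 2 ^ n) ≤ T * (∑ i, ‖x i‖ ^ p) ^ (1 / p)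

/-- The inequality which expresses, in terms of `E` itself, that the dual of `E` has type `p` with
constant `T`. Testing against weights `b` avoids the conjugate exponent of `p`. -/
def HasDualType (p T : ℝ) (E : Type*) [SeminormedAddCommGroup E] : Prop :=
  ∀ (n : ℕ) (b : Fin n → ℝ) (x : (Fin n → ℤˣ) → E), (∀ i, 0 ≤ b i) →
    ∑ i, b i * ‖∑ ε, (ε i : ℤ) • x ε‖ ≤
      2 ^ n * (T * (∑ i, b i ^ p) ^ (1 / p)) * √((∑ ε, ‖x ε‖ ^ 2) / 2 ^ n)

lemma sum_mul_le_sqrt_div {ι : Type*} [Fintype ι] (a b : ι → ℝ) {c : ℝ} (hc : 0 < c) :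
    ∑ i, a i * b i ≤ c * (√((∑ i, b i ^ 2) / c) * √((∑ i, a i ^ 2) / c)) := by
  refine (Real.sum_mul_le_sqrt_mul_sqrt _ a b).trans (le_of_eq ?_)
  rw [Real.sqrt_div (Finset.sum_nonneg fun _ _ => sq_nonneg _),
    Real.sqrt_div (Finset.sum_nonneg fun _ _ => sq_nonneg _), div_mul_div_comm,
    Real.mul_self_sqrt hc.le]
  field_simp

/-- If `F` norms `E` through a pairing, then a type inequality on `F` gives the dual inequality
on `E`. -/
lemma HasType.hasDualType_of_pairing {E F : Type*} [SeminormedAddCommGroup E]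
    [SeminormedAddCommGroup F] {p T : ℝ} (hp : 0 < p) (hT : 0 ≤ T) (h : HasType p T F)
    (B : E →+ F →+ ℝ) (hB : ∀ e f, B e f ≤ ‖e‖ * ‖f‖)
    (hn : ∀ e b δ, 0 ≤ b → 0 < δ → ∃ f, ‖f‖ ≤ b ∧ b * ‖e‖ - δ ≤ B e f) :
    HasDualType p T E := by
  intro n b x hb
  have key : ∀ δ > 0, ∑ i, b i * ‖∑ ε, (ε i : ℤ) • x ε‖ ≤
      2 ^ n * (T * (∑ i, b i ^ p) ^ (1 / p)) * √((∑ ε, ‖x ε‖ ^ 2) / 2 ^ n) + n * δ := by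
    intro δ hδ
    choose y hy1 hy2 using fun i => hn (∑ ε : Fin n → ℤˣ, (ε i : ℤ) • x ε) (b i) δ (hb i) hδ
    have h1 : ∑ i, b i * ‖∑ ε, (ε i : ℤ) • x ε‖ - n * δ ≤
        ∑ i, B (∑ ε : Fin n → ℤˣ, (ε i : ℤ) • x ε) (y i) := by
      have := Finset.sum_le_sum fun i (_ : i ∈ Finset.univ) => hy2 i
      simpa [Finset.sum_sub_distrib] using this
    have h2 : ∑ i, B (∑ ε : Fin n → ℤˣ, (ε i : ℤ) • x ε) (y i) =
        ∑ ε : Fin n → ℤˣ, B (x ε) (∑ i, (ε i : ℤ) • y i) := by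
      simp only [map_sum, AddMonoidHom.finsetSum_apply, map_zsmul, AddMonoidHom.zsmul_apply]
      exact Finset.sum_comm
    have h3 : ∑ ε : Fin n → ℤˣ, B (x ε) (∑ i, (ε i : ℤ) • y i) ≤
        ∑ ε : Fin n → ℤˣ, ‖x ε‖ * ‖∑ i, (ε i : ℤ) • y i‖ := Finset.sum_le_sum fun _ _ => hB _ _
    have h4 := sum_mul_le_sqrt_div (fun ε : Fin n → ℤˣ => ‖x ε‖)
      (fun ε => ‖∑ i, (ε i : ℤ) • y i‖) (c := 2 ^ n) (by positivity)
    have h5 : √((∑ ε : Fin n → ℤˣ, ‖∑ i, (ε i : ℤ) • y i‖ ^ 2) / 2 ^ n) ≤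
        T * (∑ i, b i ^ p) ^ (1 / p) := by
      refine (h n y).trans ?_
      gcongr with i
      exact hy1 i
    have h6 : (2 : ℝ) ^ n * (√((∑ ε : Fin n → ℤˣ, ‖∑ i, (ε i : ℤ) • y i‖ ^ 2) / 2 ^ n) *
        √((∑ ε, ‖x ε‖ ^ 2) / 2 ^ n)) ≤
        2 ^ n * (T * (∑ i, b i ^ p) ^ (1 / p)) * √((∑ ε, ‖x ε‖ ^ 2) / 2 ^ n) := by
      rw [mul_assoc]
      gcongr
    linarith
  refine le_of_forall_pos_le_add fun δ hδ => ?_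
  refine (key (δ / (n + 1)) (by positivity)).trans ?_
  gcongr
  rw [mul_div_assoc', div_le_iff₀ (by positivity)]
  nlinarith

/-- If `F` norms `E` through a pairing, then the dual inequality on `F` gives a type inequality
on `E`. -/
lemma HasDualType.hasType_of_pairing {E F : Type*} [SeminormedAddCommGroup E]
    [SeminormedAddCommGroup F] {p T : ℝ} (hT : 0 ≤ T) (h : HasDualType p T F)
    (B : E →+ F →+ ℝ) (hB : ∀ e f, B e f ≤ ‖e‖ * ‖f‖)
    (hn : ∀ e b δ, 0 ≤ b → 0 < δ → ∃ f, ‖f‖ ≤ b ∧ b * ‖e‖ - δ ≤ B e f) :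
    HasType p T E := by
  intro n x
  -- test the signed sums against vectors of `F` of norm at most `A ε` which almost norm them
  set A : (Fin n → ℤˣ) → ℝ := fun ε => ‖∑ i, (ε i : ℤ) • x i‖ with hA
  set K : ℝ := T * (∑ i, ‖x i‖ ^ p) ^ (1 / p) with hK
  have hK0 : 0 ≤ K := by positivity
  set s : ℝ := √((∑ ε, A ε ^ 2) / 2 ^ n) with hs
  have hs0 : 0 ≤ s := Real.sqrt_nonneg _
  have hs2 : s ^ 2 = (∑ ε, A ε ^ 2) / 2 ^ n := Real.sq_sqrt (by positivity)
  have key : ∀ δ > 0, s ^ 2 ≤ K * s + δ := by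
    intro δ hδ
    choose y hy1 hy2 using fun ε : Fin n → ℤˣ =>
      hn (∑ i, (ε i : ℤ) • x i) (A ε) δ (norm_nonneg _) hδ
    have h1 : ∑ ε, A ε ^ 2 - 2 ^ n * δ ≤
        ∑ ε : Fin n → ℤˣ, B (∑ i, (ε i : ℤ) • x i) (y ε) := by
      have := Finset.sum_le_sum fun ε (_ : ε ∈ Finset.univ) => hy2 ε
      simpa [Finset.sum_sub_distrib, ← pow_two, hA] using this
    have h2 : ∑ ε : Fin n → ℤˣ, B (∑ i, (ε i : ℤ) • x i) (y ε) =
        ∑ i, B (x i) (∑ ε : Fin n → ℤˣ, (ε i : ℤ) • y ε) := by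
      simp only [map_sum, AddMonoidHom.finsetSum_apply, map_zsmul, AddMonoidHom.zsmul_apply]
      exact Finset.sum_comm
    have h3 : ∑ i, B (x i) (∑ ε : Fin n → ℤˣ, (ε i : ℤ) • y ε) ≤
        ∑ i, ‖x i‖ * ‖∑ ε : Fin n → ℤˣ, (ε i : ℤ) • y ε‖ := Finset.sum_le_sum fun _ _ => hB _ _
    have h4 := h n (fun i => ‖x i‖) y fun _ => norm_nonneg _
    have h5 : √((∑ ε, ‖y ε‖ ^ 2) / 2 ^ n) ≤ s := by
      rw [hs]
      gcongr with ε
      exact hy1 ε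
    have h6 : (2 : ℝ) ^ n * K * √((∑ ε, ‖y ε‖ ^ 2) / 2 ^ n) ≤ 2 ^ n * K * s := by gcongr
    rw [hs2, div_le_iff₀ (by positivity)]
    linarith
  have h7 : s ^ 2 ≤ K * s := le_of_forall_pos_le_add key
  by_contra! hlt
  nlinarith [hK0.trans_lt hlt]

section Pairing

variable {E : Type*} [NormedAddCommGroup E] [NormedSpace ℂ E]

/-- The real part of the evaluation pairing between `E*` and `E`. -/
noncomputable def dualPairing (E : Type*) [NormedAddCommGroup E] [NormedSpace ℂ E] :
    StrongDual ℂ E →+ E →+ ℝ where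
  toFun ξ := Complex.reAddGroupHom.comp (ξ : E →+ ℂ)
  map_zero' := by ext; simp
  map_add' ξ η := by ext; simp

lemma dualPairing_apply (ξ : StrongDual ℂ E) (x : E) : dualPairing E ξ x = (ξ x).re := rfl

lemma dualPairing_le (ξ : StrongDual ℂ E) (x : E) : dualPairing E ξ x ≤ ‖ξ‖ * ‖x‖ :=
  (Complex.re_le_norm _).trans (ξ.le_opNorm x)

lemma exists_norming_vector (ξ : StrongDual ℂ E) (b δ : ℝ) (hb : 0 ≤ b) (hδ : 0 < δ) :
    ∃ x, ‖x‖ ≤ b ∧ b * ‖ξ‖ - δ ≤ dualPairing E ξ x := by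
  rcases hb.eq_or_lt with rfl | hb
  · exact ⟨0, by simp, by simp [hδ.le]⟩
  obtain ⟨x, hx1, hx2⟩ := ξ.exists_lt_apply_of_lt_opNorm (r := ‖ξ‖ - δ / b)
    (sub_lt_self _ (by positivity))
  obtain ⟨c, hc1, hc2⟩ := RCLike.exists_norm_mul_eq_self (ξ x)
  have hc : ‖conj c‖ = 1 := by rw [RCLike.norm_conj, hc1]
  have hc3 : conj c * ξ x = (‖ξ x‖ : ℂ) := by
    have : conj c * c = 1 := by rw [mul_comm, RCLike.mul_conj, hc1]; simp
    conv_lhs => rw [← hc2]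
    rw [← mul_assoc, this, one_mul]
    rfl
  refine ⟨((b : ℂ) * conj c) • x, ?_, ?_⟩
  · rw [norm_smul, norm_mul, hc, mul_one, Complex.norm_real, Real.norm_of_nonneg hb.le]
    nlinarith
  · rw [dualPairing_apply, map_smul, smul_eq_mul, mul_assoc, hc3, ← Complex.ofReal_mul,
      Complex.ofReal_re]
    have : b * (‖ξ‖ - δ / b) ≤ b * ‖ξ x‖ := by gcongr
    rwa [mul_sub, mul_div_cancel₀ _ hb.ne'] at this

lemma exists_norming_functional (x : E) (b δ : ℝ) (hb : 0 ≤ b) (hδ : 0 < δ) :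
    ∃ ξ, ‖ξ‖ ≤ b ∧ b * ‖x‖ - δ ≤ (dualPairing E).flip x ξ := by
  obtain ⟨g, hg1, hg2⟩ := exists_dual_vector'' ℂ x
  refine ⟨(b : ℂ) • g, ?_, ?_⟩
  · rw [norm_smul, Complex.norm_real, Real.norm_of_nonneg hb]
    nlinarith
  · simp [dualPairing_apply, hg2, hδ.le]

lemma HasType.strongDual {p T : ℝ} (hp : 0 < p) (hT : 0 ≤ T) (h : HasType p T E) :
    HasDualType p T (StrongDual ℂ E) :=
  h.hasDualType_of_pairing hp hT (dualPairing E) dualPairing_le exists_norming_vector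

lemma HasDualType.strongDual {p T : ℝ} (hT : 0 ≤ T) (h : HasDualType p T E) :
    HasType p T (StrongDual ℂ E) :=
  h.hasType_of_pairing hT (dualPairing E) dualPairing_le exists_norming_vector

lemma HasType.of_strongDual {p T : ℝ} (hp : 0 < p) (hT : 0 ≤ T)
    (h : HasType p T (StrongDual ℂ E)) : HasDualType p T E :=
  h.hasDualType_of_pairing hp hT (dualPairing E).flip
    (fun x ξ => (dualPairing_le ξ x).trans_eq (mul_comm _ _)) exists_norming_functional

end Pairing

/-! ### Stability of the type inequalities under completion and under `L²` -/

section Completion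

variable {S : Type*} [SeminormedAddCommGroup S]

lemma HasType.completion {p T : ℝ} (hp : 0 < p) (h : HasType p T S) :
    HasType p T (Completion S) := by
  intro n x
  have hd : DenseRange (Pi.map fun _ : Fin n => ⇑(Completion.toCompl (α := S))) :=
    DenseRange.piMap fun _ => Completion.denseRange_coe
  refine hd.induction_on (p := fun x : Fin n → Completion S =>
    √((∑ ε : Fin n → ℤˣ, ‖∑ i, (ε i : ℤ) • x i‖ ^ 2) / 2 ^ n) ≤ T * (∑ i, ‖x i‖ ^ p) ^ (1 / p))
    x ?_ fun s => ?_
  · refine isClosed_le (by fun_prop) ?_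
    have := hp.le
    refine continuous_const.mul (Continuous.rpow_const (continuous_finsetSum _ fun i _ =>
      Continuous.rpow_const (by fun_prop) fun _ => Or.inr hp.le) fun _ => Or.inr (by positivity))
  · have := h n s
    have hn : ∀ s : S, ‖Completion.toCompl s‖ = ‖s‖ := Completion.norm_coe
    simpa only [Pi.map_apply, ← map_zsmul, ← map_sum, hn] using this

lemma HasDualType.completion {p T : ℝ} (h : HasDualType p T S) :
    HasDualType p T (Completion S) := by
  intro n b x hb
  have hd : DenseRange (Pi.map fun _ : Fin n → ℤˣ => ⇑(Completion.toCompl (α := S))) :=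
    DenseRange.piMap fun _ => Completion.denseRange_coe
  refine hd.induction_on (p := fun x : (Fin n → ℤˣ) → Completion S =>
    ∑ i, b i * ‖∑ ε, (ε i : ℤ) • x ε‖ ≤
      2 ^ n * (T * (∑ i, b i ^ p) ^ (1 / p)) * √((∑ ε, ‖x ε‖ ^ 2) / 2 ^ n)) x ?_ fun s => ?_
  · exact isClosed_le (by fun_prop) (by fun_prop)
  · have := h n b s hb
    have hn : ∀ s : S, ‖Completion.toCompl s‖ = ‖s‖ := Completion.norm_coe
    simpa only [Pi.map_apply, ← map_zsmul, ← map_sum, hn] using this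

end Completion

section LTwo

variable {X : Type*} [MeasurableSpace X] {ν : Measure X}

lemma toReal_eLpNorm_two {u : X → ℝ} (hu : MemLp u 2 ν) :
    (eLpNorm u 2 ν).toReal = √(∫ x, u x ^ 2 ∂ν) := by
  rw [hu.eLpNorm_eq_integral_rpow_norm two_ne_zero ENNReal.ofNat_ne_top, ENNReal.toReal_ofReal
    (by positivity), Real.sqrt_eq_rpow]
  simp

/-- Minkowski's inequality: for `1 ≤ p ≤ 2` the `L²(ℓᵖ)` norm is at most the `ℓᵖ(L²)` norm, which is
the triangle inequality in `L^{2/p}`. -/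
lemma memLp_and_sqrt_integral_lp_le {ι : Type*} [Fintype ι] {p : ℝ} (hp1 : 1 ≤ p) (hp2 : p ≤ 2)
    (c : ι → X → ℝ) (hc0 : ∀ i x, 0 ≤ c i x) (hc : ∀ i, MemLp (c i) 2 ν) :
    MemLp (fun x => (∑ i, c i x ^ p) ^ (1 / p)) 2 ν ∧
      √(∫ x, ((∑ i, c i x ^ p) ^ (1 / p)) ^ 2 ∂ν) ≤
        (∑ i, √(∫ x, c i x ^ 2 ∂ν) ^ p) ^ (1 / p) := by
  have hp0 : 0 < p := by linarith
  set h : X → ℝ := fun x => (∑ i, c i x ^ p) ^ (1 / p) with hh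
  have hs0 : ∀ x, 0 ≤ ∑ i, c i x ^ p := fun x =>
    Finset.sum_nonneg fun i _ => Real.rpow_nonneg (hc0 i x) _
  have hh0 : ∀ x, 0 ≤ h x := fun x => Real.rpow_nonneg (hs0 x) _
  have hhp : ∀ x, h x ^ p = ∑ i, c i x ^ p := fun x => by
    rw [hh, ← Real.rpow_mul (hs0 x), one_div_mul_cancel hp0.ne', Real.rpow_one]
  have hmeas : ∀ i, AEStronglyMeasurable (fun x => c i x ^ p) ν := fun i =>
    ((hc i).1.aemeasurable.pow_const p).aestronglyMeasurable
  have hhm : AEStronglyMeasurable h ν :=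
    ((Finset.aemeasurable_fun_sum _ fun i _ => (hmeas i).aemeasurable).pow_const
      _).aestronglyMeasurable
  have hexp : ENNReal.ofReal (2 / p) * ENNReal.ofReal p = 2 := by
    rw [← ENNReal.ofReal_mul (by positivity), div_mul_cancel₀ _ hp0.ne', ENNReal.ofReal_ofNat]
  have hrp : ∀ u : X → ℝ, (∀ x, 0 ≤ u x) →
      eLpNorm (fun x => u x ^ p) (ENNReal.ofReal (2 / p)) ν = eLpNorm u 2 ν ^ p := fun u hu => by
    rw [← hexp, ← eLpNorm_norm_rpow u hp0]
    congr with x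
    rw [Real.norm_of_nonneg (hu x)]
  have hone : 1 ≤ ENNReal.ofReal (2 / p) := by
    rw [ENNReal.one_le_ofReal, le_div_iff₀ hp0]
    linarith
  have hmain : eLpNorm h 2 ν ^ p ≤ ∑ i, eLpNorm (c i) 2 ν ^ p := by
    rw [← hrp h hh0]
    simp only [← fun i => hrp (c i) (hc0 i)]
    have : (fun x => h x ^ p) = ∑ i, fun x => c i x ^ p := by
      ext x
      rw [hhp, Finset.sum_apply]
    rw [this]
    exact eLpNorm_sum_le (fun i _ => hmeas i) hone
  have hfin : ∑ i, eLpNorm (c i) 2 ν ^ p ≠ ⊤ := by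
    refine ENNReal.sum_ne_top.2 fun i _ => ENNReal.rpow_ne_top_of_nonneg hp0.le (hc i).2.ne
  have hmem : MemLp h 2 ν := by
    refine ⟨hhm, ?_⟩
    by_contra htop
    rw [not_lt, top_le_iff] at htop
    rw [htop, ENNReal.top_rpow_of_pos hp0, top_le_iff] at hmain
    exact hfin hmain
  refine ⟨hmem, ?_⟩
  rw [← toReal_eLpNorm_two hmem]
  simp only [← fun i => toReal_eLpNorm_two (hc i)]
  rw [one_div, Real.le_rpow_inv_iff_of_pos ENNReal.toReal_nonneg
    (Finset.sum_nonneg fun _ _ => by positivity) hp0]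
  have := ENNReal.toReal_mono hfin hmain
  rw [ENNReal.toReal_sum (fun i _ => ENNReal.rpow_ne_top_of_nonneg hp0.le (hc i).2.ne)] at this
  simpa only [ENNReal.toReal_rpow] using this

variable {S E : Type*} [SeminormedAddCommGroup S] [NormedAddCommGroup E]

/-- If the norm of `S` is the `L²` norm of a field of values in `E`, then `S` inherits the type
inequality of `E`. -/
lemma HasType.of_ltwo {p T : ℝ} (hp1 : 1 ≤ p) (hp2 : p ≤ 2) (hT : 0 ≤ T) (h : HasType p T E)
    (ev : S →+ X → E) (hm : ∀ F, MemLp (fun x => ‖ev F x‖) 2 ν)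
    (hnorm : ∀ F, ‖F‖ = √(∫ x, ‖ev F x‖ ^ 2 ∂ν)) : HasType p T S := by
  intro n F
  have hp0 : 0 < p := by linarith
  have hsq : ∀ F, ‖F‖ ^ 2 = ∫ x, ‖ev F x‖ ^ 2 ∂ν := fun F => by
    rw [hnorm, Real.sq_sqrt (integral_nonneg fun _ => by positivity)]
  obtain ⟨hmem, hmin⟩ := memLp_and_sqrt_integral_lp_le hp1 hp2 (fun i x => ‖ev (F i) x‖)
    (fun _ _ => norm_nonneg _) (fun i => hm (F i))
  simp only [← hnorm] at hmin
  refine le_trans ?_ (mul_le_mul_of_nonneg_left hmin hT)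
  rw [← Real.sqrt_sq hT, ← Real.sqrt_mul (sq_nonneg T), ← integral_const_mul]
  refine Real.sqrt_le_sqrt ?_
  simp only [hsq]
  rw [← integral_finsetSum _ fun ε _ => (hm _).integrable_sq, ← integral_div]
  refine integral_mono ((integrable_finsetSum _ fun ε _ => (hm _).integrable_sq).div_const _)
    (hmem.integrable_sq.const_mul _) fun x => ?_
  have := h n fun i => ev (F i) x
  rw [Real.sqrt_le_left (by positivity), mul_pow] at this
  simpa [map_sum, map_zsmul, Finset.sum_apply] using this

/-- If the norm of `S` is the `L²` norm of a field of values in `E`, then `S` inherits the dual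
type inequality of `E`. -/
lemma HasDualType.of_ltwo {p T : ℝ} (hp1 : 1 ≤ p) (hp2 : p ≤ 2) (hT : 0 ≤ T)
    (h : HasDualType p T E) (ev : S →+ X → E) (hm : ∀ F, MemLp (fun x => ‖ev F x‖) 2 ν)
    (hnorm : ∀ F, ‖F‖ = √(∫ x, ‖ev F x‖ ^ 2 ∂ν)) : HasDualType p T S := by
  intro n b F hb
  have hp0 : 0 < p := by linarith
  have hsq : ∀ F, ‖F‖ ^ 2 = ∫ x, ‖ev F x‖ ^ 2 ∂ν := fun F => by
    rw [hnorm, Real.sq_sqrt (integral_nonneg fun _ => by positivity)]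
  set H : Fin n → S := fun i => ∑ ε : Fin n → ℤˣ, (ε i : ℤ) • F ε with hH
  -- `c i` is the function of norm `b i` in `L²` which is proportional to `‖H i‖`
  set c : Fin n → X → ℝ := fun i x => b i / ‖H i‖ * ‖ev (H i) x‖ with hc
  have hc0 : ∀ i x, 0 ≤ c i x := fun i x => by have := hb i; positivity
  have hcm : ∀ i, MemLp (c i) 2 ν := fun i => (hm _).const_mul _
  obtain ⟨hmem, hmin⟩ := memLp_and_sqrt_integral_lp_le hp1 hp2 c hc0 hcm
  have hcb : ∀ i, √(∫ x, c i x ^ 2 ∂ν) ≤ b i := fun i => by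
    simp only [hc, mul_pow]
    rw [integral_const_mul, ← hsq, ← mul_pow, Real.sqrt_sq (by have := hb i; positivity)]
    rcases eq_or_ne ‖H i‖ 0 with h0 | h0
    · simp [h0, hb i]
    · rw [div_mul_cancel₀ _ h0]
  set B : X → ℝ := fun x => √((∑ ε, ‖ev (F ε) x‖ ^ 2) / 2 ^ n) with hB
  have hB2 : ∀ x, B x ^ 2 = (∑ ε, ‖ev (F ε) x‖ ^ 2) / 2 ^ n := fun x =>
    Real.sq_sqrt (by positivity)
  have hBm : MemLp B 2 ν := by
    refine (memLp_two_iff_integrable_sq ?_).2 ?_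
    · exact ((Finset.aemeasurable_fun_sum _ fun ε _ =>
        ((hm (F ε)).1.aemeasurable.pow_const 2)).div_const _).sqrt.aestronglyMeasurable
    · simp only [hB2]
      exact (integrable_finsetSum _ fun ε _ => (hm _).integrable_sq).div_const _
  have hBn : √(∫ x, B x ^ 2 ∂ν) = √((∑ ε, ‖F ε‖ ^ 2) / 2 ^ n) := by
    simp only [hB2, hsq]
    rw [integral_div, integral_finsetSum _ fun ε _ => (hm _).integrable_sq]
  set L : X → ℝ := fun x => (∑ i, c i x ^ p) ^ (1 / p) with hL
  have hL0 : ∀ x, 0 ≤ L x := fun x =>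
    Real.rpow_nonneg (Finset.sum_nonneg fun i _ => Real.rpow_nonneg (hc0 i x) _) _
  have hpt : ∀ x, ∑ i, c i x * ‖ev (H i) x‖ ≤ 2 ^ n * T * (L x * B x) := fun x => by
    have := h n (fun i => c i x) (fun ε => ev (F ε) x) fun i => hc0 i x
    simp only [hH, map_sum, map_zsmul, Finset.sum_apply, Pi.smul_apply]
    refine this.trans (le_of_eq ?_)
    ring
  have hint : ∀ i, Integrable (fun x => c i x * ‖ev (H i) x‖) ν := fun i =>
    (hcm i).integrable_mul (hm _)
  have hlhs : ∑ i, b i * ‖H i‖ = ∫ x, ∑ i, c i x * ‖ev (H i) x‖ ∂ν := by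
    rw [integral_finsetSum _ fun i _ => hint i]
    refine Finset.sum_congr rfl fun i _ => ?_
    simp only [hc, mul_assoc, ← pow_two]
    rw [integral_const_mul, ← hsq]
    rcases eq_or_ne ‖H i‖ 0 with h0 | h0
    · simp [h0]
    · field_simp
  have hcs : ∫ x, L x * B x ∂ν ≤ √(∫ x, L x ^ 2 ∂ν) * √(∫ x, B x ^ 2 ∂ν) := by
    have h2 : ENNReal.ofReal 2 = 2 := ENNReal.ofReal_ofNat 2
    have := integral_mul_le_Lp_mul_Lq_of_nonneg Real.HolderConjugate.two_two
      (Filter.Eventually.of_forall hL0) (Filter.Eventually.of_forall fun x => Real.sqrt_nonneg _)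
      (by rw [h2]; exact hmem) (by rw [h2]; exact hBm)
    simpa only [Real.rpow_two, ← Real.sqrt_eq_rpow] using this
  calc ∑ i, b i * ‖H i‖ = ∫ x, ∑ i, c i x * ‖ev (H i) x‖ ∂ν := hlhs
    _ ≤ ∫ x, 2 ^ n * T * (L x * B x) ∂ν :=
        integral_mono (integrable_finsetSum _ fun i _ => hint i)
          ((hmem.integrable_mul hBm).const_mul _) hpt
    _ = 2 ^ n * T * ∫ x, L x * B x ∂ν := integral_const_mul _ _
    _ ≤ 2 ^ n * T * ((∑ i, b i ^ p) ^ (1 / p) * √((∑ ε, ‖F ε‖ ^ 2) / 2 ^ n)) := by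
        gcongr
        refine hcs.trans ?_
        rw [hBn]
        gcongr
        refine hmin.trans ?_
        gcongr with i
        exact hcb i
    _ = _ := by ring

end LTwo

/-! ### The class of all spaces satisfying both inequalities -/

section TypeClass

lemma sum_rpow_rpow_le {ι : Type*} [Fintype ι] {p q : ℝ} (hp : 0 < p) (hpq : p ≤ q) (a : ι → ℝ)
    (ha : ∀ i, 0 ≤ a i) : (∑ i, a i ^ q) ^ (1 / q) ≤ (∑ i, a i ^ p) ^ (1 / p) := by
  set s := (∑ i, a i ^ p) ^ (1 / p) with hs
  have hq : 0 < q := hp.trans_le hpq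
  have h0 : 0 ≤ ∑ i, a i ^ p := Finset.sum_nonneg fun i _ => Real.rpow_nonneg (ha i) _
  have hs0 : 0 ≤ s := Real.rpow_nonneg h0 _
  have hsp : s ^ p = ∑ i, a i ^ p := by
    rw [hs, ← Real.rpow_mul h0, one_div_mul_cancel hp.ne', Real.rpow_one]
  have hle : ∀ i, a i ≤ s := fun i => by
    rw [← Real.rpow_le_rpow_iff (ha i) hs0 hp, hsp]
    exact Finset.single_le_sum (f := fun i => a i ^ p)
      (fun i _ => Real.rpow_nonneg (ha i) _) (Finset.mem_univ i)
  rw [one_div, Real.rpow_inv_le_iff_of_pos (Finset.sum_nonneg fun i _ =>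
    Real.rpow_nonneg (ha i) _) hs0 hq]
  have hsplit : ∀ x : ℝ, 0 ≤ x → x ^ q = x ^ p * x ^ (q - p) := fun x hx => by
    rw [← Real.rpow_add_of_nonneg hx hp.le (by linarith)]
    ring_nf
  rw [hsplit s hs0, hsp, Finset.sum_mul]
  refine Finset.sum_le_sum fun i _ => ?_
  rw [hsplit _ (ha i)]
  exact mul_le_mul_of_nonneg_left (Real.rpow_le_rpow (ha i) (hle i) (by linarith))
    (Real.rpow_nonneg (ha i) _)

lemma HasType.of_exponent_le {E : Type*} [SeminormedAddCommGroup E] {p q T : ℝ} (hp : 0 < p)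
    (hpq : p ≤ q) (hT : 0 ≤ T) (h : HasType q T E) : HasType p T E := fun n x =>
  (h n x).trans (mul_le_mul_of_nonneg_left
    (sum_rpow_rpow_le hp hpq _ fun _ => norm_nonneg _) hT)

lemma hasType_iff {E : Type*} [NormedAddCommGroup E] [NormedSpace ℂ E] {p T : ℝ} :
    HasType p T E ↔ ∀ (n : ℕ) (x : Fin n → E),
        √((∑ ε : Fin n → ℤˣ, ‖∑ i, ((ε i : ℤ) : ℂ) • x i‖ ^ 2) / 2 ^ n) ≤
          T * (∑ i, ‖x i‖ ^ p) ^ (1 / p) := by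
  simp only [HasType, Int.cast_smul_eq_zsmul]

/-- The class of all Banach spaces satisfying both type inequalities for `p` and `T`. -/
def typeClass.{w} (p T : ℝ) : BanachClass.{w} := fun E _ _ _ => HasType p T E ∧ HasDualType p T E

lemma typeClass_isOfTypeGTOne.{w} {p T : ℝ} (hp : 1 < p) (hT : 0 ≤ T) :
    (typeClass.{w} p T).IsOfTypeGTOne :=
  ⟨p, T, hp, hT, fun _ _ _ _ hE => hasType_iff.1 hE.1⟩

lemma typeClass_isStableUnderDuality.{w} {p T : ℝ} (hp : 0 < p) (hT : 0 ≤ T) :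
    (typeClass.{w} p T).IsStableUnderDuality :=
  fun _ _ _ _ hE => ⟨hE.2.strongDual hT, hE.1.strongDual hp hT⟩

lemma typeClass_isStableUnderConj.{w} {p T : ℝ} : (typeClass.{w} p T).IsStableUnderConj :=
  fun _ _ _ _ hE => hE

/-- A class of type `> 1` which is stable under duality is contained in some `typeClass p T`
with `1 < p ≤ 2`. -/
lemma BanachClass.IsOfTypeGTOne.exists_typeClass.{w} {𝓔 : BanachClass.{w}}
    (h : 𝓔.IsOfTypeGTOne) (hd : 𝓔.IsStableUnderDuality) :
    ∃ p T : ℝ, 1 < p ∧ p ≤ 2 ∧ 0 ≤ T ∧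
      ∀ (E : Type w) [NormedAddCommGroup E] [NormedSpace ℂ E] [CompleteSpace E], 𝓔 E →
        typeClass p T E := by
  obtain ⟨p, T, hp, hT, h⟩ := h
  have hp' : 1 < min p 2 := lt_min hp one_lt_two
  have key : ∀ (E : Type w) [NormedAddCommGroup E] [NormedSpace ℂ E] [CompleteSpace E], 𝓔 E →
      HasType (min p 2) T E := fun E _ _ _ hE =>
    HasType.of_exponent_le (by linarith) (min_le_left _ _) hT (hasType_iff.2 (h E hE))
  exact ⟨min p 2, T, hp', min_le_right _ _, hT, fun E _ _ _ hE =>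
    ⟨key E hE, (key _ (hd E hE)).of_strongDual (by linarith) hT⟩⟩

end TypeClass

/-! ### Uniqueness of vector-valued left-invariant integrals -/

lemma exists_cutoff {G : Type*} [TopologicalSpace G] [LocallyCompactSpace G] [T2Space G]
    {K : Set G} (hK : IsCompact K) :
    ∃ χ : C_c(G, ℝ), (∀ x, 0 ≤ χ x) ∧ (∀ x, χ x ≤ 1) ∧ ∀ x ∈ K, χ x = 1 := by
  obtain ⟨f, h1, -, h3, h4⟩ := exists_continuous_one_zero_of_isCompact hK
    (isClosed_empty (X := G)) (Set.disjoint_empty _)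
  exact ⟨⟨f, h3⟩, fun x => (h4 x).1, fun x => (h4 x).2, fun x hx => h1 hx⟩

section Uniqueness

variable {G : Type*} [Group G] [TopologicalSpace G] [IsTopologicalGroup G]
  [LocallyCompactSpace G] [T2Space G] [MeasurableSpace G] [BorelSpace G]
  {E : Type*} [NormedAddCommGroup E] [NormedSpace ℝ E] [CompleteSpace E]

/-- A linear map on `C_c(G)` which on functions supported in a given compact set is bounded for
the supremum norm, that is, a vector-valued Radon measure. -/
def IsLocallySupBounded (I : C_c(G, ℝ) →ₗ[ℝ] E) : Prop :=
  ∀ K : Set G, IsCompact K → ∃ C : ℝ, ∀ (f : C_c(G, ℝ)) (M : ℝ), (∀ x ∉ K, f x = 0) →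
    (∀ x, |f x| ≤ M) → ‖I f‖ ≤ C * M

/-- A vector-valued Radon measure commutes with integrals of continuous families of functions
with supports in a common compact set. -/
lemma IsLocallySupBounded.apply_integral {I : C_c(G, ℝ) →ₗ[ℝ] E} (hI : IsLocallySupBounded I)
    (μ : Measure G) [IsFiniteMeasureOnCompacts μ] {k : G → G → ℝ}
    (hk : Continuous fun q : G × G => k q.1 q.2) {A B : Set G} (hA : IsCompact A)
    (hB : IsCompact B) (hkA : ∀ y ∉ A, ∀ x, k y x = 0) (hkB : ∀ x ∉ B, ∀ y, k y x = 0)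
    (F : G → C_c(G, ℝ)) (hF : ∀ y x, F y x = k y x) (f : C_c(G, ℝ))
    (hf : ∀ x, f x = ∫ y, k y x ∂μ) : I f = ∫ y, I (F y) ∂μ := by
  obtain ⟨χ, hχ0, hχ1, hχB⟩ := exists_cutoff hB
  obtain ⟨C, hC⟩ := hI (tsupport χ) χ.hasCompactSupport
  -- the continuous extension `u ↦ I (χ u)` of `I` to bounded functions
  let J : BoundedContinuousFunction G ℝ →L[ℝ] E := LinearMap.mkContinuous
    { toFun := fun u => I ⟨⟨fun x => χ x * u x, by fun_prop⟩, χ.hasCompactSupport.mul_right⟩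
      map_add' := fun u v => by
        rw [← map_add]
        congr 1
        ext x
        exact mul_add _ _ _
      map_smul' := fun c u => by
        rw [← map_smul]
        congr 1
        ext x
        exact mul_left_comm _ _ _ }
    C fun u => by
      refine hC _ _ (fun x hx => ?_) fun x => ?_
      · change χ x * u x = 0
        rw [image_eq_zero_of_notMem_tsupport hx, zero_mul]
      · change |χ x * u x| ≤ ‖u‖
        rw [abs_mul, abs_of_nonneg (hχ0 x)]
        exact (mul_le_of_le_one_left (abs_nonneg _) (hχ1 x)).trans (u.norm_coe_le_norm x)
  let κ : G → BoundedContinuousFunction G ℝ := fun y =>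
    ⟨⟨F y, (F y).continuous⟩, (F y).continuous.bounded_above_of_compact_support
      (F y).hasCompactSupport |>.elim fun M hM => ⟨M + M, fun x z =>
        (dist_le_norm_add_norm _ _).trans (add_le_add (hM x) (hM z))⟩⟩
  have hκ : ∀ y x, κ y x = k y x := hF
  have hκc : Continuous κ := by
    refine continuous_iff_continuousAt.2 fun y₀ => Metric.tendsto_nhds.2 fun ε hε => ?_
    have h1 : ∀ᶠ y in 𝓝 y₀, ∀ x ∈ B, |k y x - k y₀ x| < ε / 2 := by
      refine hB.eventually_forall_of_forall_eventually fun x _ => ?_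
      have hc : Continuous fun q : G × G => |k q.1 q.2 - k y₀ q.2| :=
        (hk.sub (hk.comp (continuous_const.prodMk continuous_snd))).abs
      refine hc.continuousAt.eventually_lt continuousAt_const ?_
      simpa using hε
    filter_upwards [h1] with y hy
    refine ((BoundedContinuousFunction.dist_le (half_pos hε).le).2 fun x => ?_).trans_lt
      (half_lt_self hε)
    rw [Real.dist_eq, hκ, hκ]
    by_cases hx : x ∈ B
    · exact (hy x hx).le
    · rw [hkB x hx, hkB x hx, sub_zero, abs_zero]
      exact (half_pos hε).le
  have hκs : HasCompactSupport κ := HasCompactSupport.intro hA fun y hy => by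
    ext x
    exact (hκ y x).trans (hkA y hy x)
  have hκi : Integrable κ μ := hκc.integrable_of_hasCompactSupport hκs
  have hJκ : ∀ y, J (κ y) = I (F y) := fun y => by
    change I _ = _
    congr 1
    ext x
    change χ x * F y x = F y x
    by_cases hx : x ∈ B
    · rw [hχB x hx, one_mul]
    · rw [hF, hkB x hx, mul_zero]
  have hint : ∀ x, (∫ y, κ y ∂μ) x = ∫ y, k y x ∂μ := fun x => by
    have := (BoundedContinuousFunction.evalCLM ℝ x).integral_comp_comm hκi
    simpa only [BoundedContinuousFunction.evalCLM_apply, hκ] using this.symm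
  simp only [← hJκ]
  rw [J.integral_comp_comm hκi]
  change _ = I _
  congr 1
  ext x
  change f x = χ x * (∫ y, κ y ∂μ) x
  rw [hint, hf]
  by_cases hx : x ∈ B
  · rw [hχB x hx, one_mul]
  · simp [hkB x hx]

/-- A left-invariant vector-valued Radon measure is a vector multiple of Haar measure. -/
lemma IsLocallySupBounded.exists_eq_smul {I : C_c(G, ℝ) →ₗ[ℝ] E} (hI : IsLocallySupBounded I)
    (hinv : ∀ (h : G) (f f' : C_c(G, ℝ)), (∀ x, f' x = f (h * x)) → I f' = I f)
    (μ : Measure G) [μ.IsHaarMeasure] : ∃ w : E, ∀ f, I f = (∫ x, f x ∂μ) • w := by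
  obtain ⟨g, hgs, hg0, hg1⟩ : ∃ f : C(G, ℝ), HasCompactSupport f ∧ 0 ≤ f ∧ f 1 ≠ 0 :=
    exists_continuous_nonneg_pos 1
  have hg's : HasCompactSupport fun y => g y⁻¹ := hgs.comp_homeomorph (Homeomorph.inv G)
  have hc : 0 < ∫ y, g y⁻¹ ∂μ :=
    (g.continuous.comp continuous_inv).integral_pos_of_hasCompactSupport_nonneg_nonzero
      hg's (fun y => hg0 y⁻¹) (x := 1) (by simpa using hg1)
  let Δ : G → ℝ := fun x => Measure.modularCharacterFun x
  have hΔ : Continuous Δ := continuous_modular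
  let gΔ : C_c(G, ℝ) := ⟨⟨fun x => g x * Δ x, g.continuous.mul hΔ⟩, hgs.mul_right⟩
  refine ⟨(∫ y, g y⁻¹ ∂μ)⁻¹ • I gΔ, fun f => ?_⟩
  -- compute `∫ I(f · g(y⁻¹ ·)) dy` in two ways, `I` being invariant under `x ↦ y x`
  let F₁ : G → C_c(G, ℝ) := fun y => ⟨⟨fun x => f x * g (y⁻¹ * x),
    f.continuous.mul (g.continuous.comp (continuous_const.mul continuous_id))⟩,
    f.hasCompactSupport.mul_right⟩
  let F₂ : G → C_c(G, ℝ) := fun y => ⟨⟨fun x => g x * f (y * x),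
    g.continuous.mul (f.continuous.comp (continuous_const.mul continuous_id))⟩,
    hgs.mul_right⟩
  have h12 : ∀ y, I (F₂ y) = I (F₁ y) := fun y => hinv y _ _ fun x => by
    change g x * f (y * x) = f (y * x) * g (y⁻¹ * (y * x))
    rw [inv_mul_cancel_left, mul_comm]
  have h1 : I ((∫ y, g y⁻¹ ∂μ) • f) = ∫ y, I (F₁ y) ∂μ := by
    refine hI.apply_integral μ (k := fun y x => f x * g (y⁻¹ * x)) (A := tsupport f *
      (tsupport g)⁻¹) (B := tsupport f) ?_ (f.hasCompactSupport.isCompact.mul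
      hgs.isCompact.inv) f.hasCompactSupport ?_ ?_ _ (fun y x => rfl) _ fun x => ?_
    · exact (f.continuous.comp continuous_snd).mul
        (g.continuous.comp (continuous_fst.inv.mul continuous_snd))
    · intro y hy x
      by_contra h0
      exact hy ⟨x, subset_tsupport _ (left_ne_zero_of_mul h0), x⁻¹ * y,
        by simpa using subset_tsupport _ (right_ne_zero_of_mul h0), by simp⟩
    · intro x hx y
      rw [image_eq_zero_of_notMem_tsupport hx, zero_mul]
    · rw [integral_const_mul, ← integral_mul_left_eq_self (fun y => g y⁻¹) x⁻¹]
      simp only [mul_inv_rev, inv_inv]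
      exact mul_comm _ _
  have h2 : I ((∫ x, f x ∂μ) • gΔ) = ∫ y, I (F₂ y) ∂μ := by
    refine hI.apply_integral μ (k := fun y x => g x * f (y * x)) (A := tsupport f *
      (tsupport g)⁻¹) (B := tsupport g) ?_ (f.hasCompactSupport.isCompact.mul
      hgs.isCompact.inv) hgs ?_ ?_ _ (fun y x => rfl) _ fun x => ?_
    · exact (g.continuous.comp continuous_snd).mul
        (f.continuous.comp (continuous_fst.mul continuous_snd))
    · intro y hy x
      by_contra h0
      exact hy ⟨y * x, subset_tsupport _ (right_ne_zero_of_mul h0), x⁻¹,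
        by simpa using subset_tsupport _ (left_ne_zero_of_mul h0), by simp⟩
    · intro x hx y
      rw [image_eq_zero_of_notMem_tsupport hx, zero_mul]
    · rw [integral_const_mul, integral_mul_right_eq_modular μ (φ := fun x => f x) f.continuous
        f.hasCompactSupport]
      change _ * (g x * Δ x) = g x * (Δ x * _)
      ring
  simp only [h12] at h2
  rw [map_smul] at h1 h2
  rw [smul_comm, h2, ← h1, inv_smul_smul₀ hc.ne']

end Uniqueness

/-! ### Sums over the discrete subgroup and Weil's integration formula -/

section Lattice

variable {G : Type*} [Group G] [TopologicalSpace G] [IsTopologicalGroup G]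
  [LocallyCompactSpace G] [T2Space G] {Γ : Subgroup G} [DiscreteTopology Γ]
  {M : Type*} [NormedAddCommGroup M] [NormedSpace ℝ M]

/-- The sum `∑_γ φ(gγ) a(γ)` over the subgroup `Γ`; it is finite when `φ` has compact support. -/
noncomputable def perSum (φ : C_c(G, ℝ)) (a : Γ → M) (g : G) : M := ∑ᶠ γ : Γ, φ (g * γ) • a γ

lemma finite_setOf_coe_mem {K : Set G} (hK : IsCompact K) : {γ : Γ | (γ : G) ∈ K}.Finite := by
  have h := Γ.tendsto_coe_cofinite_of_discrete ⟨inferInstance⟩ hK.compl_mem_cocompact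
  rwa [Filter.mem_map, Filter.mem_cofinite, Set.preimage_compl, compl_compl] at h

/-- As `g` ranges over a compact set, `φ(gγ) ≠ 0` for only finitely many `γ`. -/
lemma exists_finset_forall_eq_zero (φ : C_c(G, ℝ)) {K : Set G} (hK : IsCompact K) :
    ∃ s : Finset Γ, ∀ g ∈ K, ∀ γ : Γ, φ (g * γ) ≠ 0 → γ ∈ s := by
  refine ⟨(finite_setOf_coe_mem (Γ := Γ)
    (hK.inv.mul φ.hasCompactSupport.isCompact)).toFinset, fun g hg γ h => ?_⟩
  rw [Set.Finite.mem_toFinset]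
  exact ⟨g⁻¹, by simpa using hg, g * γ, subset_tsupport _ h, by simp⟩

lemma perSum_eq_sum (φ : C_c(G, ℝ)) (a : Γ → M) (g : G) (s : Finset Γ)
    (hs : ∀ γ : Γ, φ (g * γ) ≠ 0 → γ ∈ s) : perSum φ a g = ∑ γ ∈ s, φ (g * γ) • a γ :=
  finsum_eq_sum_of_support_subset _ fun γ hγ => hs γ (left_ne_zero_of_smul hγ)

lemma exists_perSum_eq_sum (φ : C_c(G, ℝ)) {K : Set G} (hK : IsCompact K) :
    ∃ s : Finset Γ, (∀ g ∈ K, ∀ γ : Γ, φ (g * γ) ≠ 0 → γ ∈ s) ∧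
      ∀ g ∈ K, ∀ a : Γ → M, perSum φ a g = ∑ γ ∈ s, φ (g * γ) • a γ := by
  obtain ⟨s, hs⟩ := exists_finset_forall_eq_zero (Γ := Γ) φ hK
  exact ⟨s, hs, fun g hg a => perSum_eq_sum φ a g s (hs g hg)⟩

lemma exists_perSum_eq_sum_at (φ : C_c(G, ℝ)) (g : G) :
    ∃ s : Finset Γ, (∀ γ : Γ, φ (g * γ) ≠ 0 → γ ∈ s) ∧
      ∀ a : Γ → M, perSum φ a g = ∑ γ ∈ s, φ (g * γ) • a γ := by
  obtain ⟨s, hs, h⟩ := exists_perSum_eq_sum (Γ := Γ) (M := M) φ (isCompact_singleton (x := g))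
  exact ⟨s, hs g rfl, h g rfl⟩

lemma continuous_perSum (φ : C_c(G, ℝ)) (a : Γ → M) : Continuous (perSum φ a) := by
  refine continuous_iff_continuousAt.2 fun g => ?_
  obtain ⟨K, hK, hKg⟩ := exists_compact_mem_nhds g
  obtain ⟨s, -, hs⟩ := exists_perSum_eq_sum (Γ := Γ) (M := M) φ hK
  have hc : Continuous fun g => ∑ γ ∈ s, φ (g * γ) • a γ := by fun_prop
  refine hc.continuousAt.congr ?_
  filter_upwards [hKg] with x hx
  exact (hs x hx a).symm

lemma perSum_add (φ ψ : C_c(G, ℝ)) (a : Γ → M) (g : G) :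
    perSum (φ + ψ) a g = perSum φ a g + perSum ψ a g := by
  classical
  obtain ⟨s, hs, -⟩ := exists_perSum_eq_sum_at (Γ := Γ) (M := M) φ g
  obtain ⟨t, ht, -⟩ := exists_perSum_eq_sum_at (Γ := Γ) (M := M) ψ g
  have hs' : ∀ γ : Γ, φ (g * γ) ≠ 0 → γ ∈ s ∪ t := fun γ h => Finset.mem_union_left _ (hs γ h)
  have ht' : ∀ γ : Γ, ψ (g * γ) ≠ 0 → γ ∈ s ∪ t := fun γ h => Finset.mem_union_right _ (ht γ h)
  rw [perSum_eq_sum φ a g _ hs', perSum_eq_sum ψ a g _ ht', perSum_eq_sum _ a g (s ∪ t),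
    ← Finset.sum_add_distrib]
  · simp [add_smul]
  · intro γ h
    by_contra hγ
    have h1 := not_imp_comm.1 (hs' γ) hγ
    have h2 := not_imp_comm.1 (ht' γ) hγ
    exact h (by simp [h1, h2])

lemma perSum_smul (c : ℝ) (φ : C_c(G, ℝ)) (a : Γ → M) (g : G) :
    perSum (c • φ) a g = c • perSum φ a g := by
  obtain ⟨s, hs, h⟩ := exists_perSum_eq_sum_at (Γ := Γ) (M := M) φ g
  rw [h, perSum_eq_sum _ a g s, Finset.smul_sum]
  · simp [mul_smul]
  · exact fun γ hγ => hs γ fun h0 => hγ (by simp [h0])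

lemma perSum_map {M : Type*} [NormedAddCommGroup M] [NormedSpace ℂ M]
    (L : M →L[ℂ] M) (φ : C_c(G, ℝ)) (a : Γ → M) (g : G) :
    perSum φ (fun γ => L (a γ)) g = L (perSum φ a g) := by
  obtain ⟨s, -, h⟩ := exists_perSum_eq_sum_at (Γ := Γ) (M := M) φ g
  rw [h, h, map_sum]
  exact Finset.sum_congr rfl fun γ _ => (L.map_smul_of_tower _ _).symm

lemma perSum_add_right (φ : C_c(G, ℝ)) (a b : Γ → M) (g : G) :
    perSum φ (fun γ => a γ + b γ) g = perSum φ a g + perSum φ b g := by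
  obtain ⟨s, -, h⟩ := exists_perSum_eq_sum_at (Γ := Γ) (M := M) φ g
  simp only [h, smul_add, Finset.sum_add_distrib]

lemma norm_perSum_le {φ ψ : C_c(G, ℝ)} (h : ∀ x, |φ x| ≤ ψ x) (a : Γ → M) {C : ℝ}
    (ha : ∀ γ, ‖a γ‖ ≤ C) (g : G) :
    ‖perSum φ a g‖ ≤ perSum ψ (fun _ : Γ => (1 : ℝ)) g * C := by
  obtain ⟨s, hs, h1⟩ := exists_perSum_eq_sum_at (Γ := Γ) (M := ℝ) ψ g
  rw [h1, perSum_eq_sum φ a g s, Finset.sum_mul]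
  · refine (norm_sum_le _ _).trans (Finset.sum_le_sum fun γ _ => ?_)
    rw [norm_smul, Real.norm_eq_abs, smul_eq_mul, mul_one]
    exact mul_le_mul (h _) (ha γ) (norm_nonneg _) ((abs_nonneg _).trans (h _))
  · refine fun γ hγ => hs γ fun h0 => hγ ?_
    have := h (g * γ)
    rw [h0] at this
    exact abs_nonpos_iff.1 this

lemma perSum_mul_right (φ : C_c(G, ℝ)) (a : Γ → M) (g : G) (δ : Γ) :
    perSum φ a (g * δ) = perSum φ (fun γ => a (δ⁻¹ * γ)) g := by
  unfold perSum
  rw [← finsum_comp_equiv (Equiv.mulLeft δ) (f := fun γ : Γ => φ (g * γ) • a (δ⁻¹ * γ))]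
  simp [mul_assoc]

/-- The sum `∑_γ φ(gγ)`, a function on `G ⧸ Γ`. -/
noncomputable abbrev perTotal (Γ : Subgroup G) (φ : C_c(G, ℝ)) (g : G) : ℝ :=
  perSum φ (fun _ : Γ => (1 : ℝ)) g

lemma perTotal_mul_right (φ : C_c(G, ℝ)) (g : G) (δ : Γ) :
    perTotal Γ φ (g * δ) = perTotal Γ φ g := perSum_mul_right φ _ g δ

lemma perTotal_mono {φ ψ : C_c(G, ℝ)} (h : ∀ x, |φ x| ≤ ψ x) (g : G) :
    |perTotal Γ φ g| ≤ perTotal Γ ψ g := by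
  have := norm_perSum_le h (fun _ : Γ => (1 : ℝ)) (C := 1) (by simp) g
  rwa [mul_one] at this

lemma perTotal_nonneg {φ : C_c(G, ℝ)} (h : ∀ x, 0 ≤ φ x) (g : G) : 0 ≤ perTotal Γ φ g :=
  (abs_nonneg _).trans (perTotal_mono (φ := φ) (fun x => (abs_of_nonneg (h x)).le) g)

lemma perSum_eq_zero (φ : C_c(G, ℝ)) (a : Γ → M) (g : G) (h : ∀ γ : Γ, g * γ ∉ tsupport φ) :
    perSum φ a g = 0 := by
  rw [perSum_eq_sum φ a g ∅ fun γ hγ => absurd (subset_tsupport _ hγ) (h γ), Finset.sum_empty]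

lemma exists_perTotal_le (φ : C_c(G, ℝ)) : ∃ C, ∀ g, perTotal Γ φ g ≤ C := by
  obtain ⟨C, hC⟩ := φ.hasCompactSupport.isCompact.exists_bound_of_continuousOn
    (continuous_perSum φ fun _ : Γ => (1 : ℝ)).continuousOn
  refine ⟨max C 0, fun g => ?_⟩
  by_cases h : ∃ γ : Γ, g * γ ∈ tsupport φ
  · obtain ⟨γ, hγ⟩ := h
    rw [← perTotal_mul_right φ g γ]
    exact (le_abs_self _).trans ((hC _ hγ).trans (le_max_left _ _))
  · push Not at h
    rw [perTotal, perSum_eq_zero φ _ g h]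
    exact le_max_right _ _

/-- The absolute value of a function in `C_c(G)`. -/
noncomputable def ccAbs (φ : C_c(G, ℝ)) : C_c(G, ℝ) :=
  ⟨⟨fun x => |φ x|, by fun_prop⟩, φ.hasCompactSupport.comp_left (g := fun t => |t|) abs_zero⟩

lemma exists_abs_perTotal_le (φ : C_c(G, ℝ)) : ∃ C, ∀ g, |perTotal Γ φ g| ≤ C := by
  obtain ⟨C, hC⟩ := exists_perTotal_le (Γ := Γ) (ccAbs φ)
  exact ⟨C, fun g => (perTotal_mono (ψ := ccAbs φ) (fun _ => le_rfl) g).trans (hC g)⟩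

/-- The product of a function in `C_c(G)` with a continuous function. -/
def ccMul (φ : C_c(G, ℝ)) {u : G → ℝ} (hu : Continuous u) : C_c(G, ℝ) :=
  ⟨⟨fun g => φ g * u g, φ.continuous.mul hu⟩, φ.hasCompactSupport.mul_right⟩

lemma perTotal_ccMul (φ : C_c(G, ℝ)) {u : G → ℝ} (hc : Continuous u)
    (hu : ∀ (g : G) (γ : Γ), u (g * γ) = u g) (g : G) :
    perTotal Γ (ccMul φ hc) g = perTotal Γ φ g * u g := by
  obtain ⟨s, hs, h⟩ := exists_perSum_eq_sum_at (Γ := Γ) (M := ℝ) φ g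
  rw [perTotal, perTotal, perSum_eq_sum _ _ g s fun γ hγ => hs γ (left_ne_zero_of_mul hγ), h,
    Finset.sum_mul]
  refine Finset.sum_congr rfl fun γ _ => ?_
  change (φ (g * γ) * u (g * γ)) * 1 = _
  rw [hu, smul_eq_mul, mul_one, mul_one]

/-- Over a set which is compact modulo `Γ`, the constant `1` is a sum over `Γ`. -/
lemma exists_perTotal_eq_one (Γ : Subgroup G) [DiscreteTopology Γ] {K : Set G}
    (hK : IsCompact K) :
    ∃ ψ : C_c(G, ℝ), (∀ x, 0 ≤ ψ x) ∧ (∀ g, perTotal Γ ψ g ≤ 1) ∧ ∀ g ∈ K, perTotal Γ ψ g = 1 := by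
  obtain ⟨χ, hχ0, -, hχK⟩ := exists_cutoff hK
  have hc : Continuous fun g => max (perTotal Γ χ g) 1 :=
    (continuous_perSum χ _).max continuous_const
  have hpos : ∀ g, 0 < max (perTotal Γ χ g) 1 := fun g => lt_max_of_lt_right one_pos
  have key := perTotal_ccMul (Γ := Γ) χ (u := fun g => (max (perTotal Γ χ g) 1)⁻¹)
    (hc.inv₀ fun g => (hpos g).ne') fun g γ => by simp only [perTotal_mul_right]
  refine ⟨ccMul χ (u := fun g => (max (perTotal Γ χ g) 1)⁻¹) (hc.inv₀ fun g => (hpos g).ne'),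
    fun x => mul_nonneg (hχ0 x) (inv_nonneg.2 (hpos x).le), ?_⟩
  refine ⟨fun g => ?_, fun g hg => ?_⟩
  · rw [key, ← div_eq_mul_inv, div_le_one (hpos g)]
    exact le_max_left _ _
  · have h1 : 1 ≤ perTotal Γ χ g := by
      obtain ⟨s, hs, h1⟩ := exists_perSum_eq_sum_at (Γ := Γ) (M := ℝ) χ g
      rw [perTotal, h1]
      have h2 := Finset.single_le_sum (f := fun γ : Γ => χ (g * γ) • (1 : ℝ))
        (fun γ _ => by simpa using hχ0 _) (hs 1 (by simp [hχK g hg]))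
      simpa [hχK g hg] using h2
    rw [key, max_eq_left h1, mul_inv_cancel₀ (by linarith)]

section Quotient

lemma apply_out {M : Type*} {u : G → M} (hu : ∀ (g : G) (γ : Γ), u (g * γ) = u g) (g : G) :
    u ((g : G ⧸ Γ).out) = u g := by
  obtain ⟨γ, hγ⟩ := QuotientGroup.mk_out_eq_mul Γ g
  rw [hγ, hu]

lemma continuous_comp_out {M : Type*} [TopologicalSpace M] {u : G → M} (hc : Continuous u)
    (hu : ∀ (g : G) (γ : Γ), u (g * γ) = u g) : Continuous fun x : G ⧸ Γ => u x.out := by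
  rw [(QuotientGroup.isQuotientMap_mk Γ).continuous_iff]
  have : (fun x : G ⧸ Γ => u x.out) ∘ (QuotientGroup.mk : G → G ⧸ Γ) = u :=
    funext fun g => apply_out hu g
  rwa [this]

lemma apply_smul_out {M : Type*} {u : G → M} (hu : ∀ (g : G) (γ : Γ), u (g * γ) = u g) (h : G)
    (x : G ⧸ Γ) : u ((h • x).out) = u (h * x.out) := by
  have : h • x = ((h * x.out : G) : G ⧸ Γ) := by
    conv_lhs => rw [← QuotientGroup.out_eq' x]
    rfl
  rw [this, apply_out hu]

variable [MeasurableSpace (G ⧸ Γ)] [BorelSpace (G ⧸ Γ)] (ν : Measure (G ⧸ Γ))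
  [IsFiniteMeasure ν]

/-- Choosing representatives identifies right `Γ`-invariant functions on `G` with functions on
`G ⧸ Γ`; the choice need not be measurable. -/
lemma memLp_comp_out {u : G → ℝ} (hc : Continuous u) (hu : ∀ (g : G) (γ : Γ), u (g * γ) = u g)
    {C : ℝ} (hC : ∀ g, |u g| ≤ C) (p : ENNReal) : MemLp (fun x : G ⧸ Γ => u x.out) p ν :=
  MemLp.of_bound (continuous_comp_out hc hu).aestronglyMeasurable C (.of_forall fun _ => hC _)

lemma integrable_perTotal (φ : C_c(G, ℝ)) : Integrable (fun x : G ⧸ Γ => perTotal Γ φ x.out) ν := by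
  obtain ⟨C, hC⟩ := exists_abs_perTotal_le (Γ := Γ) φ
  exact memLp_one_iff_integrable.1
    (memLp_comp_out ν (continuous_perSum φ _) (perTotal_mul_right φ) hC 1)

/-- A compact subset of `G ⧸ Γ` lifts to a compact subset of `G`. -/
lemma exists_isCompact_lift {K : Set (G ⧸ Γ)} (hK : IsCompact K) :
    ∃ L : Set G, IsCompact L ∧ K ⊆ QuotientGroup.mk '' L := by
  choose N hN hN' using fun g : G => exists_compact_mem_nhds g
  obtain ⟨t, -, ht⟩ := hK.elim_nhds_subcover
    (fun x => (QuotientGroup.mk : G → G ⧸ Γ) '' N x.out) fun x _ => by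
      have := QuotientGroup.isOpenMap_coe (N := Γ) |>.image_mem_nhds (hN' x.out)
      rwa [QuotientGroup.out_eq'] at this
  refine ⟨⋃ x ∈ t, N x.out, t.isCompact_biUnion fun x _ => hN _, ?_⟩
  simpa only [Set.image_iUnion] using ht

/-- Inner regularity of `ν`: functions on `G ⧸ Γ` with values in `[0, 1]` which are `1` on a suitable
compact set have almost full integral. -/
lemma exists_isCompact_integral_ge [ν.Regular] {r : ℝ} (hr0 : 0 ≤ r) (hr : r < ν.real Set.univ) :
    ∃ K : Set G, IsCompact K ∧ ∀ u : G → ℝ, Continuous u → (∀ (g : G) (γ : Γ), u (g * γ) = u g) →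
      (∀ g, 0 ≤ u g) → (∀ g, u g ≤ 1) → (∀ g ∈ K, u g = 1) →
      r ≤ ∫ x : G ⧸ Γ, u x.out ∂ν ∧ ∫ x : G ⧸ Γ, u x.out ∂ν ≤ ν.real Set.univ := by
  have hr' : ENNReal.ofReal r < ν Set.univ :=
    (ENNReal.ofReal_lt_iff_lt_toReal hr0 (measure_ne_top ν _)).2 hr
  obtain ⟨C, -, hC, hCr⟩ := isOpen_univ.exists_lt_isCompact hr'
  obtain ⟨K, hK, hKC⟩ := exists_isCompact_lift hC
  refine ⟨K, hK, fun u hc hu h0 h1 hK1 => ?_⟩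
  have hm : Measurable fun x : G ⧸ Γ => u x.out := (continuous_comp_out hc hu).measurable
  have hi : Integrable (fun x : G ⧸ Γ => u x.out) ν := memLp_one_iff_integrable.1
    (memLp_comp_out ν hc hu (C := 1) (fun g => by rw [abs_of_nonneg (h0 g)]; exact h1 g) 1)
  set A : Set (G ⧸ Γ) := {x | u x.out = 1} with hA
  have hAm : MeasurableSet A := hm (measurableSet_singleton 1)
  have hCA : C ⊆ A := fun x hx => by
    obtain ⟨g, hg, rfl⟩ := hKC hx
    exact (apply_out hu g).trans (hK1 g hg)
  constructor
  · calc r ≤ ν.real A := by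
          refine (ENNReal.ofReal_le_iff_le_toReal (measure_ne_top ν _)).1 ?_
          exact hCr.le.trans (measure_mono hCA)
      _ = ∫ x, A.indicator (fun _ => (1 : ℝ)) x ∂ν := by simp [integral_indicator hAm]
      _ ≤ _ := integral_mono ((integrable_const _).indicator hAm) hi fun x =>
          Set.indicator_le' (fun _ hx => (Eq.symm hx).le) (fun x _ => h0 _) x
  · calc _ ≤ ∫ _ : G ⧸ Γ, (1 : ℝ) ∂ν := integral_mono hi (integrable_const _) fun x => h1 _
      _ = _ := by simp

variable [SMulInvariantMeasure G (G ⧸ Γ) ν]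

lemma integral_translate_out {u : G → ℝ} (hu : ∀ (g : G) (γ : Γ), u (g * γ) = u g) (h : G) :
    ∫ x : G ⧸ Γ, u (h * x.out) ∂ν = ∫ x : G ⧸ Γ, u x.out ∂ν := by
  rw [← integral_smul_eq_self (fun x : G ⧸ Γ => u x.out) (g := h)]
  simp only [apply_smul_out hu]

/-- Weil's integration formula: for a suitable normalization of Haar measure on `G`,
`∫_G f = ∫_{G ⧸ Γ} ∑_γ f(gγ)`. -/
lemma exists_haar_integral_eq [ν.Regular] (hν : ν ≠ 0) [MeasurableSpace G] [BorelSpace G] :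
    ∃ μ : Measure G, μ.IsHaarMeasure ∧
      ∀ f : C_c(G, ℝ), ∫ x, f x ∂μ = ∫ x : G ⧸ Γ, perTotal Γ f x.out ∂ν := by
  let I : C_c(G, ℝ) →ₗ[ℝ] ℝ :=
    { toFun := fun f => ∫ x : G ⧸ Γ, perTotal Γ f x.out ∂ν
      map_add' := fun f f' => by
        simp only [perTotal, perSum_add]
        exact integral_add (integrable_perTotal ν f) (integrable_perTotal ν f')
      map_smul' := fun c f => by
        simp only [perTotal, perSum_smul]
        exact integral_smul c _ }
  have hI : IsLocallySupBounded I := by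
    intro K hK
    obtain ⟨χ, hχ0, -, hχK⟩ := exists_cutoff hK
    refine ⟨∫ x : G ⧸ Γ, perTotal Γ χ x.out ∂ν, fun f M hf hM => ?_⟩
    have hM0 : 0 ≤ M := (abs_nonneg _).trans (hM 1)
    have hle : ∀ x, |f x| ≤ (M • χ) x := fun x => by
      by_cases hx : x ∈ K
      · simpa [hχK x hx] using hM x
      · simpa [hf x hx] using mul_nonneg hM0 (hχ0 x)
    rw [← integral_mul_const]
    refine norm_integral_le_of_norm_le ((integrable_perTotal ν χ).mul_const M)
      (.of_forall fun x => ?_)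
    refine (perTotal_mono hle _).trans_eq ?_
    rw [perTotal, perSum_smul, smul_eq_mul, mul_comm]
  have hinv : ∀ (h : G) (f f' : C_c(G, ℝ)), (∀ x, f' x = f (h * x)) → I f' = I f := by
    intro h f f' hf
    change ∫ x : G ⧸ Γ, perTotal Γ f' x.out ∂ν = ∫ x : G ⧸ Γ, perTotal Γ f x.out ∂ν
    rw [← integral_translate_out ν (perTotal_mul_right f) h]
    simp only [perTotal, perSum, hf, mul_assoc]
  obtain ⟨c, hc⟩ := hI.exists_eq_smul hinv Measure.haar
  have hvol : 0 < ν.real Set.univ := by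
    have := NeZero.mk hν
    exact measureReal_univ_pos
  have hc0 : 0 < c := by
    obtain ⟨K, hK, h⟩ := exists_isCompact_integral_ge ν (half_pos hvol).le (half_lt_self hvol)
    obtain ⟨ψ, hψ0, hψ1, hψK⟩ := exists_perTotal_eq_one Γ hK
    have h1 := (h _ (continuous_perSum ψ _) (perTotal_mul_right ψ) (perTotal_nonneg hψ0) hψ1
      hψK).1
    have h2 : 0 < (∫ x, ψ x ∂Measure.haar) * c :=
      ((half_pos hvol).trans_le h1).trans_eq (hc ψ)
    exact pos_of_mul_pos_right h2 (integral_nonneg hψ0)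
  refine ⟨ENNReal.ofReal c • Measure.haar, Measure.IsHaarMeasure.smul _
    (ENNReal.ofReal_pos.2 hc0).ne' ENNReal.ofReal_ne_top, fun f => ?_⟩
  rw [integral_smul_measure, ENNReal.toReal_ofReal hc0.le, smul_eq_mul, mul_comm]
  exact (hc f).symm

end Quotient

end Lattice

/-! ### The induced representation -/

lemma IsometricRep.norm_apply {H : Type*} [Group H] [TopologicalSpace H] {E : Type*}
    [NormedAddCommGroup E] [NormedSpace ℂ E] (π : IsometricRep H E) (h : H) (x : E) :
    ‖π.toHom h x‖ = ‖x‖ := by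
  have hle : ∀ (h : H) (x : E), ‖π.toHom h x‖ ≤ ‖x‖ := fun h x => by
    simpa using (π.toHom h).le_of_opNorm_le (π.norm_le_one h) x
  refine le_antisymm (hle h x) ?_
  have := hle h⁻¹ (π.toHom h x)
  rwa [← mul_apply_eq_comp, ← map_mul, inv_mul_cancel, map_one,
    one_apply_eq_self] at this

section Induced

variable {G : Type*} [Group G] [TopologicalSpace G] [IsTopologicalGroup G]
  [LocallyCompactSpace G] [T2Space G] {Γ : Subgroup G} [DiscreteTopology Γ]
  {E : Type*} [NormedAddCommGroup E] [NormedSpace ℂ E]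

/-- The continuous maps `F : G → E` with `F(gγ) = π(γ)⁻¹ F(g)` for `γ ∈ Γ` whose support is compact
modulo `Γ`. -/
def indSections (π : IsometricRep Γ E) : Submodule ℂ (G → E) where
  carrier := {F | Continuous F ∧ (∀ (g : G) (γ : Γ), F (g * γ) = π.toHom γ⁻¹ (F g)) ∧
    ∃ K : Set G, IsCompact K ∧ ∀ g, F g ≠ 0 → ∃ γ : Γ, g * γ ∈ K}
  zero_mem' := ⟨continuous_const, fun _ _ => (map_zero _).symm, ∅, isCompact_empty,
    fun _ h => absurd rfl h⟩
  add_mem' := by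
    rintro F F' ⟨h1, h2, K, hK, h3⟩ ⟨h1', h2', K', hK', h3'⟩
    refine ⟨h1.add h1', fun g γ => ?_, K ∪ K', hK.union hK', fun g hg => ?_⟩
    · simp only [Pi.add_apply, map_add, h2, h2']
    · by_cases h : F g = 0
      · obtain ⟨γ, hγ⟩ := h3' g fun h' => hg (by simp [h, h'])
        exact ⟨γ, Or.inr hγ⟩
      · obtain ⟨γ, hγ⟩ := h3 g h
        exact ⟨γ, Or.inl hγ⟩
  smul_mem' := by
    rintro c F ⟨h1, h2, K, hK, h3⟩
    refine ⟨h1.const_smul c, fun g γ => ?_, K, hK, fun g hg => h3 g fun h => hg (by simp [h])⟩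
    simp only [Pi.smul_apply, map_smul, h2]

section

variable [MeasurableSpace (G ⧸ Γ)] [BorelSpace (G ⧸ Γ)] (ν : Measure (G ⧸ Γ))

/-- The sections `indSections π`, seminormed by the `L²(G ⧸ Γ, ν)` norm of the `Γ`-invariant
function `g ↦ ‖F(g)‖`. -/
def IndSec (π : IsometricRep Γ E) : Type _ :=
  let _ := ν
  indSections π

variable {ν} {π : IsometricRep Γ E}

noncomputable instance : AddCommGroup (IndSec ν π) :=
  inferInstanceAs (AddCommGroup (indSections π))

noncomputable instance : Module ℂ (IndSec ν π) := inferInstanceAs (Module ℂ (indSections π))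

namespace IndSec

/-- A section as a function on `G`. -/
def fn (F : IndSec ν π) : G → E := F.1

/-- The section given by a function. -/
def mk (F : G → E) (h : F ∈ indSections π) : IndSec ν π := ⟨F, h⟩

lemma fn_mk (F : G → E) (h : F ∈ indSections π) : (mk F h : IndSec ν π).fn = F := rfl

lemma ext {F F' : IndSec ν π} (h : ∀ g, F.fn g = F'.fn g) : F = F' := Subtype.ext (funext h)

lemma fn_add (F F' : IndSec ν π) (g : G) : (F + F').fn g = F.fn g + F'.fn g := rfl

lemma fn_smul (c : ℂ) (F : IndSec ν π) (g : G) : (c • F).fn g = c • F.fn g := rfl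

lemma fn_zero (g : G) : (0 : IndSec ν π).fn g = 0 := rfl

lemma fn_neg (F : IndSec ν π) (g : G) : (-F).fn g = -F.fn g := rfl

lemma fn_sub (F F' : IndSec ν π) (g : G) : (F - F').fn g = F.fn g - F'.fn g := rfl

lemma continuous_fn (F : IndSec ν π) : Continuous F.fn := F.2.1

lemma fn_mul (F : IndSec ν π) (g : G) (γ : Γ) : F.fn (g * γ) = π.toHom γ⁻¹ (F.fn g) := F.2.2.1 g γ

lemma exists_support (F : IndSec ν π) :
    ∃ K : Set G, IsCompact K ∧ ∀ g, F.fn g ≠ 0 → ∃ γ : Γ, g * γ ∈ K := F.2.2.2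

lemma norm_fn_mul (F : IndSec ν π) (g : G) (γ : Γ) : ‖F.fn (g * γ)‖ = ‖F.fn g‖ := by
  rw [fn_mul, π.norm_apply]

lemma exists_bound (F : IndSec ν π) : ∃ C, ∀ g, ‖F.fn g‖ ≤ C := by
  obtain ⟨K, hK, hF⟩ := F.exists_support
  obtain ⟨C, hC⟩ := hK.exists_bound_of_continuousOn F.continuous_fn.continuousOn
  refine ⟨max C 0, fun g => ?_⟩
  by_cases h : F.fn g = 0
  · simp [h]
  · obtain ⟨γ, hγ⟩ := hF g h
    rw [← F.norm_fn_mul g γ]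
    exact (hC _ hγ).trans (le_max_left _ _)

variable [IsFiniteMeasure ν]

lemma memLp_norm (F : IndSec ν π) (p : ENNReal) :
    MemLp (fun x : G ⧸ Γ => ‖F.fn x.out‖) p ν := by
  obtain ⟨C, hC⟩ := F.exists_bound
  exact memLp_comp_out ν (u := fun g => ‖F.fn g‖) F.continuous_fn.norm F.norm_fn_mul
    (C := C) (fun g => by rw [abs_of_nonneg (norm_nonneg _)]; exact hC g) p

noncomputable instance : SeminormedAddCommGroup (IndSec ν π) :=
  AddGroupSeminorm.toSeminormedAddCommGroup
    { toFun := fun F : IndSec ν π => (eLpNorm (fun x : G ⧸ Γ => ‖F.fn x.out‖) 2 ν).toReal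
      map_zero' := by simp [fn_zero]
      add_le' := fun F F' => by
        rw [← ENNReal.toReal_add (F.memLp_norm 2).2.ne (F'.memLp_norm 2).2.ne]
        refine ENNReal.toReal_mono (ENNReal.add_ne_top.2
          ⟨(F.memLp_norm 2).2.ne, (F'.memLp_norm 2).2.ne⟩) ?_
        refine le_trans (eLpNorm_mono_real fun x => ?_)
          (eLpNorm_add_le (F.memLp_norm 2).1 (F'.memLp_norm 2).1 one_le_two)
        rw [norm_norm]
        exact norm_add_le _ _
      neg' := fun F => by simp only [fn_neg, norm_neg] }

lemma norm_eq (F : IndSec ν π) : ‖F‖ = √(∫ x : G ⧸ Γ, ‖F.fn x.out‖ ^ 2 ∂ν) :=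
  toReal_eLpNorm_two (F.memLp_norm 2)

noncomputable instance : NormedSpace ℂ (IndSec ν π) where
  norm_smul_le c F := by
    rw [norm_eq, norm_eq]
    simp only [fn_smul, norm_smul, mul_pow]
    rw [integral_const_mul, Real.sqrt_mul (sq_nonneg _), Real.sqrt_sq (norm_nonneg _)]

/-- The values of a section at representatives of the cosets. -/
noncomputable def ev : IndSec ν π →+ (G ⧸ Γ) → E where
  toFun F x := F.fn x.out
  map_zero' := rfl
  map_add' _ _ := rfl

lemma norm_le_of_forall_le (F : IndSec ν π) {M : ℝ} (hM0 : 0 ≤ M) (hM : ∀ g, ‖F.fn g‖ ≤ M) :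
    ‖F‖ ≤ M * √(ν.real Set.univ) := by
  rw [norm_eq]
  calc √(∫ x : G ⧸ Γ, ‖F.fn x.out‖ ^ 2 ∂ν) ≤ √(∫ _ : G ⧸ Γ, M ^ 2 ∂ν) := by
        refine Real.sqrt_le_sqrt (integral_mono (F.memLp_norm 2).integrable_sq
          (integrable_const _) fun x => ?_)
        exact pow_le_pow_left₀ (norm_nonneg _) (hM _) 2
    _ = M * √(ν.real Set.univ) := by
        rw [integral_const, smul_eq_mul, mul_comm, Real.sqrt_mul (sq_nonneg _),
          Real.sqrt_sq hM0]

lemma integral_norm_le (F : IndSec ν π) :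
    ∫ x : G ⧸ Γ, ‖F.fn x.out‖ ∂ν ≤ √(ν.real Set.univ) * ‖F‖ := by
  have h2 : ENNReal.ofReal 2 = 2 := ENNReal.ofReal_ofNat 2
  have := integral_mul_le_Lp_mul_Lq_of_nonneg (μ := ν) Real.HolderConjugate.two_two
    (f := fun _ : G ⧸ Γ => (1 : ℝ)) (g := fun x : G ⧸ Γ => ‖F.fn x.out‖)
    (Filter.Eventually.of_forall fun _ => zero_le_one)
    (Filter.Eventually.of_forall fun x => norm_nonneg _)
    (memLp_const 1) (by rw [h2]; exact F.memLp_norm 2)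
  rw [norm_eq]
  simpa [Real.sqrt_eq_rpow] using this

section Action

variable [SMulInvariantMeasure G (G ⧸ Γ) ν]

/-- The left translate `g ↦ F(h⁻¹g)` of a section. -/
def translate (h : G) (F : IndSec ν π) : IndSec ν π :=
  mk (fun g => F.fn (h⁻¹ * g)) (by
    refine ⟨F.continuous_fn.comp (continuous_const.mul continuous_id), fun g γ => ?_, ?_⟩
    · change F.fn (h⁻¹ * (g * γ)) = π.toHom γ⁻¹ (F.fn (h⁻¹ * g))
      rw [← mul_assoc, F.fn_mul]
    · obtain ⟨K, hK, hF⟩ := F.exists_support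
      refine ⟨h • K, hK.smul h, fun g hg => ?_⟩
      obtain ⟨γ, hγ⟩ := hF _ hg
      exact ⟨γ, _, hγ, by simp [mul_assoc]⟩)

lemma fn_translate (h : G) (F : IndSec ν π) (g : G) : (translate h F).fn g = F.fn (h⁻¹ * g) := rfl

/-- Left translation as a linear isometry. -/
noncomputable def translateₗᵢ (h : G) : IndSec ν π →ₗᵢ[ℂ] IndSec ν π where
  toFun := translate h
  map_add' _ _ := rfl
  map_smul' _ _ := rfl
  norm_map' F := by
    rw [norm_eq, norm_eq]
    congr 1
    exact integral_translate_out ν (u := fun g => ‖F.fn g‖ ^ 2)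
      (fun g γ => by rw [F.norm_fn_mul]) h⁻¹

lemma continuous_translate (F : IndSec ν π) : Continuous fun h : G => translate h F := by
  obtain ⟨K, hK, hF⟩ := F.exists_support
  -- the supports of the translates by `h` near `h₀` are in one compact set modulo `Γ`, where the
  -- continuity is uniform; the volume being finite, it holds in `L²`
  refine continuous_iff_continuousAt.2 fun h₀ => Metric.tendsto_nhds.2 fun ε hε => ?_
  set V : ℝ := √(ν.real Set.univ)
  have hV : 0 ≤ V := Real.sqrt_nonneg _
  obtain ⟨N, hN, hN₀⟩ := exists_compact_mem_nhds h₀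
  have h1 : ∀ᶠ h in 𝓝 h₀, ∀ g ∈ N * K, ‖F.fn (h⁻¹ * g) - F.fn (h₀⁻¹ * g)‖ < ε / (V + 1) := by
    refine (hN.mul hK).eventually_forall_of_forall_eventually fun g _ => ?_
    have hc : Continuous fun q : G × G => ‖F.fn (q.1⁻¹ * q.2) - F.fn (h₀⁻¹ * q.2)‖ :=
      ((F.continuous_fn.comp (continuous_fst.inv.mul continuous_snd)).sub
        (F.continuous_fn.comp (continuous_const.mul continuous_snd))).norm
    refine hc.continuousAt.eventually_lt continuousAt_const ?_
    simp only [sub_self, norm_zero]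
    positivity
  filter_upwards [h1, hN₀] with h hh hhN
  have h2 : ∀ g, ‖(translate h F - translate h₀ F).fn g‖ ≤ ε / (V + 1) := by
    intro g
    have hmem : ∀ h' ∈ N, F.fn (h'⁻¹ * g) ≠ 0 → ∃ γ : Γ, g * γ ∈ N * K := fun h' hh' h0 => by
      obtain ⟨γ, hγ⟩ := hF _ h0
      exact ⟨γ, h', hh', _, hγ, by simp [mul_assoc]⟩
    by_cases hg : ∃ γ : Γ, g * γ ∈ N * K
    · obtain ⟨γ, hγ⟩ := hg
      rw [← norm_fn_mul _ g γ]
      exact (hh _ hγ).le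
    · have e1 : F.fn (h⁻¹ * g) = 0 := by
        by_contra h0
        exact hg (hmem h hhN h0)
      have e2 : F.fn (h₀⁻¹ * g) = 0 := by
        by_contra h0
        exact hg (hmem h₀ (mem_of_mem_nhds hN₀) h0)
      rw [fn_sub, fn_translate, fn_translate, e1, e2, sub_zero, norm_zero]
      positivity
  rw [dist_eq_norm]
  refine (norm_le_of_forall_le _ (by positivity) h2).trans_lt ?_
  change ε / (V + 1) * V < ε
  rw [div_mul_eq_mul_div, div_lt_iff₀ (by positivity)]
  nlinarith

end Action

end IndSec

variable [IsFiniteMeasure ν] [SMulInvariantMeasure G (G ⧸ Γ) ν]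

variable (ν) in
/-- The space of the representation induced by `π`: the completion of `IndSec ν π`. -/
abbrev IndSpace (π : IsometricRep Γ E) : Type _ := Completion (IndSec ν π)

variable (ν) in
/-- The isometric representation of `G` induced by the representation `π` of `Γ`, by left
translation on `L²` sections. -/
noncomputable def indRep (π : IsometricRep Γ E) : IsometricRep G (IndSpace ν π) where
  toHom :=
    { toFun := fun h => (IndSec.translateₗᵢ h).toContinuousLinearMap.completion
      map_one' := by
        ext x
        induction x using Completion.induction_on with
        | hp =>
          exact isClosed_eq (ContinuousLinearMap.continuous _) (ContinuousLinearMap.continuous _)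
        | ih F =>
          rw [ContinuousLinearMap.completion_apply_coe]
          refine congrArg _ (IndSec.ext fun g => ?_)
          change F.fn (1⁻¹ * g) = F.fn g
          simp
      map_mul' := fun h h' => by
        ext x
        induction x using Completion.induction_on with
        | hp =>
          exact isClosed_eq (ContinuousLinearMap.continuous _) (ContinuousLinearMap.continuous _)
        | ih F =>
          rw [mul_apply_eq_comp]
          simp only [ContinuousLinearMap.completion_apply_coe]
          refine congrArg _ (IndSec.ext fun g => ?_)
          change F.fn ((h * h')⁻¹ * g) = F.fn (h'⁻¹ * (h⁻¹ * g))
          rw [mul_inv_rev, mul_assoc] }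
  norm_le_one h := by
    refine ContinuousLinearMap.opNorm_le_bound _ zero_le_one fun x => ?_
    induction x using Completion.induction_on with
    | hp => exact isClosed_le (ContinuousLinearMap.continuous _).norm (by fun_prop)
    | ih F =>
      refine le_of_eq ?_
      change ‖(IndSec.translateₗᵢ h).toContinuousLinearMap.completion (F : IndSpace ν π)‖ = _
      rw [ContinuousLinearMap.completion_apply_coe, Completion.norm_coe, Completion.norm_coe,
        one_mul]
      exact (IndSec.translateₗᵢ h).norm_map F
  continuous_apply x := by
    refine continuous_of_uniform_approx_of_continuous fun u hu => ?_
    obtain ⟨ε, hε, hεu⟩ := Metric.mem_uniformity_dist.1 hu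
    obtain ⟨F, hF⟩ := (Completion.denseRange_coe (α := IndSec ν π)).exists_dist_lt x hε
    refine ⟨fun h => ((IndSec.translate h F : IndSec ν π) : IndSpace ν π),
      (Completion.continuous_coe _).comp F.continuous_translate, fun h => hεu ?_⟩
    have h1 : ((IndSec.translate h F : IndSec ν π) : IndSpace ν π) =
        (IndSec.translateₗᵢ h).toContinuousLinearMap.completion (F : IndSpace ν π) :=
      (ContinuousLinearMap.completion_apply_coe
        (IndSec.translateₗᵢ h).toContinuousLinearMap F).symm
    have h2 : ∀ y : IndSpace ν π,
        ‖(IndSec.translateₗᵢ h).toContinuousLinearMap.completion y‖ = ‖y‖ := fun y => by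
      induction y using Completion.induction_on with
      | hp => exact isClosed_eq (ContinuousLinearMap.continuous _).norm (by fun_prop)
      | ih F =>
        rw [ContinuousLinearMap.completion_apply_coe, Completion.norm_coe, Completion.norm_coe]
        exact (IndSec.translateₗᵢ h).norm_map F
    change dist ((IndSec.translateₗᵢ h).toContinuousLinearMap.completion x)
      ((IndSec.translate h F : IndSec ν π) : IndSpace ν π) < ε
    rwa [h1, dist_eq_norm, ← map_sub, h2, ← dist_eq_norm]

lemma indRep_coe (h : G) (F : IndSec ν π) :
    (indRep ν π).toHom h (F : IndSpace ν π) = (IndSec.translate h F : IndSec ν π) :=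
  ContinuousLinearMap.completion_apply_coe (IndSec.translateₗᵢ h).toContinuousLinearMap F

lemma typeClass_indSpace {p T : ℝ} (hp1 : 1 ≤ p) (hp2 : p ≤ 2) (hT : 0 ≤ T) [CompleteSpace E]
    (hE : typeClass p T E) : typeClass p T (IndSpace ν π) :=
  ⟨(hE.1.of_ltwo hp1 hp2 hT (ν := ν) (S := IndSec ν π) IndSec.ev (fun F => F.memLp_norm 2)
      fun F => F.norm_eq).completion (by linarith),
    (hE.2.of_ltwo hp1 hp2 hT (ν := ν) (S := IndSec ν π) IndSec.ev (fun F => F.memLp_norm 2)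
      fun F => F.norm_eq).completion⟩

end

end Induced

/-! ### Averages of sections and matrix coefficients -/

section Coefficient

variable {G : Type*} [Group G] [TopologicalSpace G] [IsTopologicalGroup G]
  [LocallyCompactSpace G] [T2Space G] [MeasurableSpace G] [BorelSpace G] {Γ : Subgroup G}
  [DiscreteTopology Γ] {μ : Measure G} [μ.IsHaarMeasure]

/-- The coefficient `∫ ψ(g) φ(h⁻¹gγ) dg` of `π(γ)` in the compression of the translation by `h`. -/
noncomputable def coeff (μ : Measure G) (ψ φ : C_c(G, ℝ)) (γ : Γ) (h : G) : ℝ :=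
  ∫ g, ψ g * φ (h⁻¹ * g * γ) ∂μ

lemma continuous_coeff (ψ φ : C_c(G, ℝ)) (γ : Γ) : Continuous (coeff μ ψ φ γ) := by
  rw [← continuousOn_univ]
  refine continuousOn_integral_of_compact_support ψ.hasCompactSupport.isCompact
    (Continuous.continuousOn ?_) fun x y _ hy => ?_
  · exact (ψ.continuous.comp continuous_snd).mul (φ.continuous.comp
      ((continuous_fst.inv.mul continuous_snd).mul continuous_const))
  · rw [image_eq_zero_of_notMem_tsupport hy, zero_mul]

/-- A finite set of `γ` outside of which the coefficients vanish on `H`. -/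
def CoeffSupport (ψ φ : C_c(G, ℝ)) (H : Set G) (s : Finset Γ) : Prop :=
  ∀ h ∈ H, ∀ g ∈ tsupport ψ, ∀ γ : Γ, φ (h⁻¹ * g * γ) ≠ 0 → γ ∈ s

lemma exists_coeffSupport (ψ φ : C_c(G, ℝ)) {H : Set G} (hH : IsCompact H) :
    ∃ s : Finset Γ, CoeffSupport ψ φ H s := by
  obtain ⟨s, hs⟩ := exists_finset_forall_eq_zero (Γ := Γ) φ
    (hH.inv.mul ψ.hasCompactSupport.isCompact)
  exact ⟨s, fun h hh g hg γ hγ => hs _ ⟨h⁻¹, by simpa using hh, g, hg, rfl⟩ γ hγ⟩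

lemma CoeffSupport.coeff_eq_zero {ψ φ : C_c(G, ℝ)} {H : Set G} {s : Finset Γ}
    (hs : CoeffSupport ψ φ H s) {h : G} (hh : h ∈ H) {γ : Γ} (hγ : γ ∉ s) :
    coeff μ ψ φ γ h = 0 := by
  have : ∀ g, ψ g * φ (h⁻¹ * g * γ) = 0 := fun g => by
    by_cases hg : g ∈ tsupport ψ
    · rw [not_imp_comm.1 (hs h hh g hg γ) hγ, mul_zero]
    · rw [image_eq_zero_of_notMem_tsupport hg, zero_mul]
  simp [coeff, this]

end Coefficient

section Average

variable {G : Type*} [Group G] [TopologicalSpace G] [IsTopologicalGroup G]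
  [LocallyCompactSpace G] [T2Space G] [MeasurableSpace G] [BorelSpace G] {Γ : Subgroup G}
  [DiscreteTopology Γ] [MeasurableSpace (G ⧸ Γ)] [BorelSpace (G ⧸ Γ)] {μ : Measure G}
  [μ.IsHaarMeasure] {ν : Measure (G ⧸ Γ)} [IsFiniteMeasure ν]

/-- The normalization of `μ` and `ν` for which Weil's formula holds. -/
def WeilFormula (Γ : Subgroup G) [MeasurableSpace (G ⧸ Γ)] (μ : Measure G)
    (ν : Measure (G ⧸ Γ)) : Prop :=
  ∀ f : C_c(G, ℝ), ∫ x, f x ∂μ = ∫ x : G ⧸ Γ, perTotal Γ f x.out ∂ν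

/-- Weil's formula makes Haar measure on `G` right invariant under `Γ`. -/
lemma WeilFormula.integral_mul_right (hW : WeilFormula Γ μ ν) {E : Type*} [NormedAddCommGroup E]
    [NormedSpace ℝ E] [CompleteSpace E] {f : G → E} (hf : Continuous f) (hfs : HasCompactSupport f)
    (γ : Γ) : ∫ x, f (x * γ) ∂μ = ∫ x, f x ∂μ := by
  have hreal : ∀ u : C_c(G, ℝ), ∫ x, u (x * γ) ∂μ = ∫ x, u x ∂μ := fun u => by
    have h1 := hW ⟨⟨fun x => u (x * γ), by fun_prop⟩,
      u.hasCompactSupport.comp_homeomorph (Homeomorph.mulRight (γ : G))⟩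
    refine h1.trans ?_
    rw [hW u]
    congr 1 with x
    unfold perTotal perSum
    rw [← finsum_comp_equiv (Equiv.mulRight γ) (f := fun δ : Γ => u (x.out * δ) • (1 : ℝ))]
    refine finsum_congr fun δ => ?_
    change u (x.out * δ * γ) • (1 : ℝ) = u (x.out * (δ * γ : Γ)) • (1 : ℝ)
    rw [Subgroup.coe_mul, mul_assoc]
  refine (SeparatingDual.eq_iff_forall_dual_eq (R := ℝ)).2 fun L => ?_
  have hf' : Continuous fun x => f (x * γ) := by fun_prop
  rw [← L.integral_comp_comm (hf.integrable_of_hasCompactSupport hfs),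
    ← L.integral_comp_comm (hf'.integrable_of_hasCompactSupport
      (hfs.comp_homeomorph (Homeomorph.mulRight (γ : G))))]
  exact hreal ⟨⟨fun x => L (f x), L.continuous.comp hf⟩, hfs.comp_left (map_zero L)⟩

/-- Replacing `γ` by `γ⁻¹` and `h` by `h⁻¹` exchanges the two functions. -/
lemma WeilFormula.coeff_inv (hW : WeilFormula Γ μ ν) (ψ φ : C_c(G, ℝ)) (γ : Γ) (h : G) :
    coeff μ ψ φ γ h⁻¹ = coeff μ φ ψ γ⁻¹ h := by
  have hc : Continuous fun g => ψ (h⁻¹ * g) * φ (g * γ) := by fun_prop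
  unfold coeff
  rw [← integral_mul_left_eq_self _ h⁻¹]
  simp only [inv_inv, mul_inv_cancel_left]
  have hs : HasCompactSupport fun g => φ g * ψ (h⁻¹ * g * (γ⁻¹ : Γ)) :=
    φ.hasCompactSupport.mul_right
  rw [← hW.integral_mul_right (f := fun g => φ g * ψ (h⁻¹ * g * (γ⁻¹ : Γ))) (by fun_prop) hs γ]
  congr 1 with g
  simp [mul_assoc, mul_comm]

variable {E : Type*} [NormedAddCommGroup E] [NormedSpace ℂ E] {π : IsometricRep Γ E}

lemma integrable_average (ψ : C_c(G, ℝ)) {f : G → E} (hf : Continuous f) :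
    Integrable (fun g => ψ g • f g) μ :=
  (ψ.continuous.smul hf).integrable_of_hasCompactSupport ψ.hasCompactSupport.smul_right

lemma WeilFormula.norm_integral_le (hW : WeilFormula Γ μ ν) (ψ : C_c(G, ℝ)) {C : ℝ}
    (hC : ∀ g, perTotal Γ (ccAbs ψ) g ≤ C) (F : IndSec ν π) :
    ‖∫ g, ψ g • F.fn g ∂μ‖ ≤ C * √(ν.real Set.univ) * ‖F‖ := by
  have hC0 : 0 ≤ C := (perTotal_nonneg (fun x => abs_nonneg (ψ x)) 1).trans (hC 1)
  have hinv : ∀ (g : G) (γ : Γ), ‖F.fn (g * γ)‖ = ‖F.fn g‖ := F.norm_fn_mul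
  have hi := (F.memLp_norm 1)
  rw [memLp_one_iff_integrable] at hi
  calc ‖∫ g, ψ g • F.fn g ∂μ‖ ≤ ∫ g, ‖ψ g • F.fn g‖ ∂μ := norm_integral_le_integral_norm _
    _ = ∫ g, ccMul (ccAbs ψ) F.continuous_fn.norm g ∂μ := by
        congr 1 with g
        rw [norm_smul]
        rfl
    _ = ∫ x : G ⧸ Γ, perTotal Γ (ccAbs ψ) x.out * ‖F.fn x.out‖ ∂ν := by
        rw [hW]
        simp only [perTotal_ccMul _ F.continuous_fn.norm hinv]
    _ ≤ ∫ x : G ⧸ Γ, C * ‖F.fn x.out‖ ∂ν := by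
        refine integral_mono_of_nonneg (.of_forall fun x => mul_nonneg
          (perTotal_nonneg (fun x => abs_nonneg (ψ x)) _) (norm_nonneg _)) (hi.const_mul C)
          (.of_forall fun x => ?_)
        exact mul_le_mul_of_nonneg_right (hC _) (norm_nonneg _)
    _ ≤ C * √(ν.real Set.univ) * ‖F‖ := by
        rw [integral_const_mul, mul_assoc]
        exact mul_le_mul_of_nonneg_left F.integral_norm_le hC0

variable [CompleteSpace E]

/-- The average `F ↦ ∫ ψ(g) F(g) dg` of sections, extended to the induced space. -/
noncomputable def average (hW : WeilFormula Γ μ ν) (π : IsometricRep Γ E) (ψ : C_c(G, ℝ)) :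
    IndSpace ν π →L[ℂ] E :=
  (LinearMap.mkContinuous
    { toFun := fun F : IndSec ν π => ∫ g, ψ g • F.fn g ∂μ
      map_add' := fun F F' => by
        simp only [IndSec.fn_add, smul_add]
        exact integral_add (integrable_average ψ F.continuous_fn)
          (integrable_average ψ F'.continuous_fn)
      map_smul' := fun c F => by
        simp only [IndSec.fn_smul, smul_comm _ c]
        exact integral_smul c _ }
    ((exists_perTotal_le (Γ := Γ) (ccAbs ψ)).choose * √(ν.real Set.univ))
    (hW.norm_integral_le ψ (exists_perTotal_le (Γ := Γ) (ccAbs ψ)).choose_spec)).fromCompletion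

lemma average_coe (hW : WeilFormula Γ μ ν) (ψ : C_c(G, ℝ)) (F : IndSec ν π) :
    average hW π ψ (F : IndSpace ν π) = ∫ g, ψ g • F.fn g ∂μ :=
  ContinuousLinearMap.fromCompletion_apply_coe _ _

lemma norm_average_le (hW : WeilFormula Γ μ ν) (ψ : C_c(G, ℝ)) {C : ℝ}
    (hC : ∀ g, perTotal Γ (ccAbs ψ) g ≤ C) (x : IndSpace ν π) :
    ‖average hW π ψ x‖ ≤ C * √(ν.real Set.univ) * ‖x‖ := by
  induction x using Completion.induction_on with
  | hp => exact isClosed_le (ContinuousLinearMap.continuous _).norm (by fun_prop)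
  | ih F =>
    rw [average_coe, Completion.norm_coe]
    exact hW.norm_integral_le ψ hC F

lemma average_add (hW : WeilFormula Γ μ ν) (ψ ψ' : C_c(G, ℝ)) (x : IndSpace ν π) :
    average hW π (ψ + ψ') x = average hW π ψ x + average hW π ψ' x := by
  induction x using Completion.induction_on with
  | hp => exact isClosed_eq (by fun_prop) (by fun_prop)
  | ih F =>
    simp only [average_coe]
    rw [← integral_add (integrable_average ψ F.continuous_fn)
      (integrable_average ψ' F.continuous_fn)]
    simp [add_smul]

lemma average_smul (hW : WeilFormula Γ μ ν) (c : ℝ) (ψ : C_c(G, ℝ)) (x : IndSpace ν π) :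
    average hW π (c • ψ) x = c • average hW π ψ x := by
  induction x using Completion.induction_on with
  | hp => exact isClosed_eq (by fun_prop) (by fun_prop)
  | ih F =>
    simp only [average_coe]
    rw [← integral_smul]
    simp [mul_smul]

lemma toHom_average (hW : WeilFormula Γ μ ν) (γ : Γ) (ψ ψ' : C_c(G, ℝ))
    (hψ : ∀ x, ψ' x = ψ (x * γ)) (x : IndSpace ν π) :
    π.toHom γ (average hW π ψ x) = average hW π ψ' x := by
  induction x using Completion.induction_on with
  | hp => exact isClosed_eq (by fun_prop) (by fun_prop)
  | ih F =>
    rw [average_coe, average_coe, ← ContinuousLinearMap.integral_comp_comm _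
      (integrable_average ψ F.continuous_fn)]
    have hF : Continuous F.fn := F.continuous_fn
    have hc : Continuous fun g => π.toHom γ (ψ g • F.fn g) := by fun_prop
    have hs : HasCompactSupport fun g => π.toHom γ (ψ g • F.fn g) :=
      HasCompactSupport.intro ψ.hasCompactSupport fun g hg => by
        simp [image_eq_zero_of_notMem_tsupport hg]
    rw [← hW.integral_mul_right hc hs γ]
    refine integral_congr_ae (.of_forall fun g => ?_)
    change π.toHom γ (ψ (g * γ) • F.fn (g * γ)) = ψ' g • F.fn g
    rw [(π.toHom γ).map_smul_of_tower, F.fn_mul, ← mul_apply_eq_comp, ← map_mul, mul_inv_cancel,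
      map_one, one_apply_eq_self, hψ]

variable (ν) in
/-- The section `g ↦ ∑_γ φ(gγ) π(γ) v`, as a vector of the induced space depending on `v`. -/
noncomputable def sectionMap (π : IsometricRep Γ E) (φ : C_c(G, ℝ)) : E →L[ℂ] IndSpace ν π :=
  Completion.toComplL ∘L LinearMap.mkContinuous
    { toFun := fun v => (IndSec.mk (perSum φ fun γ => π.toHom γ v)
        ⟨continuous_perSum φ _, fun g δ => by
          rw [perSum_mul_right, ← perSum_map]
          simp only [← mul_apply_eq_comp, ← map_mul],
        tsupport φ, φ.hasCompactSupport, fun g hg => by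
          by_contra! h
          exact hg (perSum_eq_zero φ _ g h)⟩ : IndSec ν π)
      map_add' := fun v v' => IndSec.ext fun g => by
        rw [IndSec.fn_add]
        simp only [map_add]
        exact perSum_add_right φ _ _ g
      map_smul' := fun c v => IndSec.ext fun g => by
        rw [RingHom.id_apply, IndSec.fn_smul]
        simp only [IndSec.fn_mk, map_smul]
        exact perSum_map (c • ContinuousLinearMap.id ℂ E) φ (fun γ => π.toHom γ v) g }
    ((exists_perTotal_le (Γ := Γ) (ccAbs φ)).choose * √(ν.real Set.univ)) fun v => by
      have hC := (exists_perTotal_le (Γ := Γ) (ccAbs φ)).choose_spec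
      set C := (exists_perTotal_le (Γ := Γ) (ccAbs φ)).choose
      have hC0 : 0 ≤ C := (perTotal_nonneg (fun x => abs_nonneg (φ x)) 1).trans (hC 1)
      refine (IndSec.norm_le_of_forall_le _ (mul_nonneg hC0 (norm_nonneg v)) fun g => ?_).trans_eq
        (by ring)
      refine (norm_perSum_le (ψ := ccAbs φ) (fun _ => le_rfl) _ (C := ‖v‖)
        (fun γ => (π.norm_apply γ v).le) g).trans ?_
      exact mul_le_mul_of_nonneg_right (hC g) (norm_nonneg v)

lemma exists_sectionMap_eq (φ : C_c(G, ℝ)) (v : E) : ∃ F : IndSec ν π,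
    (∀ g, F.fn g = perSum φ (fun γ => π.toHom γ v) g) ∧ sectionMap ν π φ v = (F : IndSpace ν π) :=
  ⟨_, fun _ => rfl, rfl⟩

lemma norm_sectionMap_le (φ : C_c(G, ℝ)) {C : ℝ} (hC : ∀ g, perTotal Γ (ccAbs φ) g ≤ C) :
    ‖sectionMap ν π φ‖ ≤ C * √(ν.real Set.univ) := by
  have hC0 : 0 ≤ C := (perTotal_nonneg (fun x => abs_nonneg (φ x)) 1).trans (hC 1)
  refine ContinuousLinearMap.opNorm_le_bound _ (by positivity) fun v => ?_
  obtain ⟨F, hF, hFv⟩ := exists_sectionMap_eq (ν := ν) (π := π) φ v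
  rw [hFv, Completion.norm_coe]
  refine (F.norm_le_of_forall_le (mul_nonneg hC0 (norm_nonneg v)) fun g => ?_).trans_eq (by ring)
  rw [hF]
  refine (norm_perSum_le (ψ := ccAbs φ) (fun _ => le_rfl) _ (C := ‖v‖)
    (fun γ => (π.norm_apply γ v).le) g).trans ?_
  exact mul_le_mul_of_nonneg_right (hC g) (norm_nonneg v)

variable [SMulInvariantMeasure G (G ⧸ Γ) ν]

lemma average_indRep (hW : WeilFormula Γ μ ν) (h : G) (ψ ψ' : C_c(G, ℝ))
    (hψ : ∀ x, ψ' x = ψ (h * x)) (x : IndSpace ν π) :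
    average hW π ψ ((indRep ν π).toHom h x) = average hW π ψ' x := by
  induction x using Completion.induction_on with
  | hp => exact isClosed_eq (by fun_prop) (by fun_prop)
  | ih F =>
    rw [indRep_coe, average_coe, average_coe, ← integral_mul_left_eq_self _ h]
    simp [IndSec.fn_translate, hψ]

/-- An invariant vector of the induced representation is a constant section, whose value is a
`Γ`-invariant vector of `E`. -/
lemma exists_average_eq_smul (hW : WeilFormula Γ μ ν) {x : IndSpace ν π}
    (hx : x ∈ (indRep ν π).invariants) :
    ∃ w ∈ π.invariants, ∀ ψ, average hW π ψ x = (∫ g, ψ g ∂μ) • w := by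
  let I : C_c(G, ℝ) →ₗ[ℝ] E :=
    { toFun := fun ψ => average hW π ψ x
      map_add' := fun ψ ψ' => average_add hW ψ ψ' x
      map_smul' := fun c ψ => average_smul hW c ψ x }
  have hI : IsLocallySupBounded I := by
    intro K hK
    obtain ⟨χ, hχ0, -, hχK⟩ := exists_cutoff hK
    obtain ⟨C, hC⟩ := exists_perTotal_le (Γ := Γ) χ
    refine ⟨C * √(ν.real Set.univ) * ‖x‖, fun f M hf hM => ?_⟩
    have hM0 : 0 ≤ M := (abs_nonneg _).trans (hM 1)
    have hle : ∀ x, |ccAbs f x| ≤ (M • χ) x := fun x => by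
      change |(|f x|)| ≤ M * χ x
      rw [abs_abs]
      by_cases hx : x ∈ K
      · simpa [hχK x hx] using hM x
      · simpa [hf x hx] using mul_nonneg hM0 (hχ0 x)
    refine (norm_average_le hW f (C := M * C) (fun g => ?_) x).trans_eq (by ring)
    refine (le_abs_self _).trans ((perTotal_mono hle g).trans ?_)
    rw [perTotal, perSum_smul]
    exact mul_le_mul_of_nonneg_left (hC g) hM0
  obtain ⟨w, hw⟩ := hI.exists_eq_smul (fun h f f' hf => by
    change average hW π f' x = average hW π f x
    rw [← average_indRep hW h f f' hf, hx h]) μ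
  refine ⟨w, fun γ => ?_, hw⟩
  obtain ⟨ψ, hψs, hψ0, hψ1⟩ : ∃ f : C(G, ℝ), HasCompactSupport f ∧ 0 ≤ f ∧ f 1 ≠ 0 :=
    exists_continuous_nonneg_pos 1
  have hpos : 0 < ∫ g, ψ g ∂μ :=
    ψ.continuous.integral_pos_of_hasCompactSupport_nonneg_nonzero hψs hψ0 hψ1
  let ψ₁ : C_c(G, ℝ) := ⟨ψ, hψs⟩
  let ψ₂ : C_c(G, ℝ) := ⟨⟨fun g => ψ (g * γ), by fun_prop⟩,
    hψs.comp_homeomorph (Homeomorph.mulRight (γ : G))⟩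
  have h1 := toHom_average hW γ ψ₁ ψ₂ (fun _ => rfl) x
  have h2 : ∫ g, ψ₂ g ∂μ = ∫ g, ψ₁ g ∂μ := hW.integral_mul_right ψ.continuous hψs γ
  rw [show average hW π ψ₁ x = _ from hw ψ₁, show average hW π ψ₂ x = _ from hw ψ₂, h2,
    (π.toHom γ).map_smul_of_tower] at h1
  exact smul_right_injective E (show ∫ g, ψ₁ g ∂μ ≠ 0 from hpos.ne') h1

lemma CoeffSupport.average_eq_sum {ψ φ : C_c(G, ℝ)} {H : Set G} {s : Finset Γ}
    (hs : CoeffSupport ψ φ H s) (hW : WeilFormula Γ μ ν) {h : G} (hh : h ∈ H) (v : E) :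
    average hW π ψ ((indRep ν π).toHom h (sectionMap ν π φ v)) =
      ∑ γ ∈ s, coeff μ ψ φ γ h • π.toHom γ v := by
  obtain ⟨F, hF, hFv⟩ := exists_sectionMap_eq (ν := ν) (π := π) φ v
  rw [hFv, indRep_coe, average_coe]
  have hpt : ∀ g, ψ g • (IndSec.translate h F).fn g =
      ∑ γ ∈ s, (ψ g * φ (h⁻¹ * g * γ)) • π.toHom γ v := fun g => by
    by_cases hg : g ∈ tsupport ψ
    · rw [IndSec.fn_translate, hF, perSum_eq_sum φ _ _ s (hs h hh g hg), Finset.smul_sum]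
      simp only [mul_smul]
    · simp [image_eq_zero_of_notMem_tsupport hg]
  simp only [hpt]
  have hc : ∀ γ : Γ, Continuous fun g => φ (h⁻¹ * g * γ) := fun γ => by fun_prop
  rw [integral_finsetSum]
  · refine Finset.sum_congr rfl fun γ _ => ?_
    rw [integral_smul_const]
    rfl
  · intro γ _
    exact (integrable_average (E := ℂ) ψ (f := fun g => (φ (h⁻¹ * g * γ) : ℂ))
      (Complex.continuous_ofReal.comp (hc γ))).re.smul_const (π.toHom γ v) |>.congr
        (.of_forall fun g => by simp)

end Average

/-! ### The operators `π(a)` for `a` in the completed algebra -/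

section Algebra

universe w

variable {H : Type*} [Group H] [TopologicalSpace H] [IsTopologicalGroup H]
  [LocallyCompactSpace H] [MeasurableSpace H] [BorelSpace H] {𝓔 : BanachClass.{w}}
  {μ : Measure H} [IsFiniteMeasureOnCompacts μ]

lemma norm_ofCc (f : C_c(H, ℂ)) : ‖ofCc 𝓔 μ f‖ = sSup (repNorms 𝓔 μ f) :=
  (Completion.norm_coe _).trans (norm_toCcAlg 𝓔 μ f)

@[elab_as_elim]
lemma induction_ofCc {P : CAlg 𝓔 μ → Prop} (a : CAlg 𝓔 μ) (hc : IsClosed {a | P a})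
    (h : ∀ f : C_c(H, ℂ), P (ofCc 𝓔 μ f)) : P a := Completion.induction_on a hc h

lemma exists_norm_sub_ofCc_lt (a : CAlg 𝓔 μ) {ε : ℝ} (hε : 0 < ε) :
    ∃ f : C_c(H, ℂ), ‖a - ofCc 𝓔 μ f‖ < ε := by
  obtain ⟨f, hf⟩ := (Completion.denseRange_coe (α := CcAlg 𝓔 μ)).exists_dist_lt a hε
  exact ⟨f, by rwa [dist_eq_norm] at hf⟩

variable {E : Type w} [NormedAddCommGroup E] [NormedSpace ℂ E] [CompleteSpace E] (hE : 𝓔 E)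
  (π : IsometricRep H E)

lemma norm_repOp_le (a : CAlg 𝓔 μ) : ‖repOp μ hE π a‖ ≤ ‖a‖ := by
  induction a using induction_ofCc with
  | hc => exact isClosed_le (repOp μ hE π).continuous.norm continuous_norm
  | h f =>
    rw [repOp_ofCc, norm_ofCc]
    exact norm_integrate_le_sSup 𝓔 μ hE π f

lemma repOp_mul [μ.IsMulLeftInvariant] (a b : CAlg 𝓔 μ) :
    repOp μ hE π (a * b) = repOp μ hE π a ∘L repOp μ hE π b := by
  induction a using induction_ofCc with
  | hc =>
    exact isClosed_eq ((repOp μ hE π).continuous.comp ((mulL 𝓔 μ).continuous.clm_apply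
      continuous_const)) ((repOp μ hE π).continuous.clm_comp continuous_const)
  | h f =>
    induction b using induction_ofCc with
    | hc =>
      exact isClosed_eq ((repOp μ hE π).continuous.comp (mulL 𝓔 μ (ofCc 𝓔 μ f)).continuous)
        (continuous_const.clm_comp (repOp μ hE π).continuous)
    | h f' =>
      rw [ofCc_mul_ofCc, repOp_ofCc, repOp_ofCc, repOp_ofCc]
      exact π.integrate_conv μ f f'

/-- An element of `C_0^𝓔(H)` which acts by zero in all representations is zero. -/
lemma eq_zero_of_repOp_eq_zero (a : CAlg 𝓔 μ)
    (h : ∀ (E : Type w) [NormedAddCommGroup E] [NormedSpace ℂ E] [CompleteSpace E] (hE : 𝓔 E)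
      (π : IsometricRep H E), repOp μ hE π a = 0) : a = 0 := by
  refine norm_le_zero_iff.1 (le_of_forall_pos_le_add fun ε hε => ?_)
  obtain ⟨f, hf⟩ := exists_norm_sub_ofCc_lt a (half_pos hε)
  have hle : ‖ofCc 𝓔 μ f‖ ≤ ε / 2 := by
    rw [norm_ofCc]
    refine Real.sSup_le ?_ (half_pos hε).le
    rintro _ ⟨E, _, _, _, hE, π, rfl⟩
    have h1 := norm_repOp_le hE π (a - ofCc 𝓔 μ f)
    rw [map_sub, h E hE π, zero_sub, norm_neg, repOp_ofCc] at h1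
    exact h1.trans hf.le
  have := norm_add_le (a - ofCc 𝓔 μ f) (ofCc 𝓔 μ f)
  rw [sub_add_cancel] at this
  linarith

lemma eq_of_repOp_eq {a b : CAlg 𝓔 μ}
    (h : ∀ (E : Type w) [NormedAddCommGroup E] [NormedSpace ℂ E] [CompleteSpace E] (hE : 𝓔 E)
      (π : IsometricRep H E), repOp μ hE π a = repOp μ hE π b) : a = b :=
  sub_eq_zero.1 (eq_zero_of_repOp_eq_zero _ fun E _ _ _ hE π => by
    rw [map_sub, h E hE π, sub_self])

/-- The trivial representation. -/
def trivialRep (H : Type*) [Group H] [TopologicalSpace H] (E : Type*) [NormedAddCommGroup E]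
    [NormedSpace ℂ E] : IsometricRep H E where
  toHom := 1
  norm_le_one _ := ContinuousLinearMap.norm_id_le
  continuous_apply _ := continuous_const

end Algebra

/-! ### Transfer from the group to the subgroup -/

/-- A discrete group is unimodular: translates of a point mass have equal integrals. -/
lemma modularCharacterFun_eq_one_of_discrete {H : Type*} [Group H] [TopologicalSpace H]
    [IsTopologicalGroup H] [DiscreteTopology H] [MeasurableSpace H] [BorelSpace H] (h : H) :
    Measure.modularCharacterFun h = 1 := by
  classical
  let φ : H → ℝ := Pi.single 1 1
  have hφs : HasCompactSupport φ := HasCompactSupport.intro (isCompact_singleton (x := (1 : H)))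
    fun x hx => Pi.single_eq_of_ne hx _
  have hint : ∀ a : H, ∫ x, (Pi.single a 1 : H → ℝ) x ∂(Measure.haar : Measure H) =
      (Measure.haar : Measure H).real {1} := fun a => by
    have : (Pi.single a 1 : H → ℝ) = Set.indicator {a} fun _ => 1 := by
      ext x
      by_cases hx : x = a
      · subst hx; simp
      · simp [hx]
    rw [this, integral_indicator (measurableSet_singleton a)]
    simp [measureReal_def]
  have h1 := integral_mul_right_eq_modular (Measure.haar : Measure H) (φ := φ)
    continuous_of_discreteTopology hφs h
  have h2 : (fun x => φ (x * h)) = (Pi.single h⁻¹ 1 : H → ℝ) := by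
    ext x
    simp only [φ, Pi.single_apply, mul_eq_one_iff_eq_inv]
  rw [h2, hint, hint] at h1
  have h3 : (Measure.haar : Measure H).real {1} ≠ 0 := by
    refine (ENNReal.toReal_pos ?_ ?_).ne'
    · exact ((isOpen_discrete _).measure_pos _ (Set.singleton_nonempty _)).ne'
    · exact isCompact_singleton.measure_ne_top
  have h4 : (Measure.modularCharacterFun h : ℝ) = 1 := by
    field_simp at h1
    exact h1.symm
  exact_mod_cast h4

section Transfer

variable {G : Type*} [Group G] [TopologicalSpace G] [IsTopologicalGroup G]
  [LocallyCompactSpace G] [T2Space G] [MeasurableSpace G] [BorelSpace G] {Γ : Subgroup G}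
  [DiscreteTopology Γ] (μ : Measure G) [μ.IsHaarMeasure]

lemma integrable_mul_coeff (f : C_c(G, ℂ)) (ψ φ : C_c(G, ℝ)) (γ : Γ) :
    Integrable (fun h => f h * (coeff μ ψ φ γ h : ℂ)) μ :=
  (f.continuous.mul (Complex.continuous_ofReal.comp
    (continuous_coeff ψ φ γ))).integrable_of_hasCompactSupport f.hasCompactSupport.mul_right

/-- The map from functions on `G` to functions on `Γ` which sends the Dirac mass at `h` to the
function `γ ↦ κ ∫ φ(g) φ(h⁻¹gγ) dg`. -/
noncomputable def transfer (φ : C_c(G, ℝ)) (κ : ℝ) (f : C_c(G, ℂ)) : C_c(Γ, ℂ) where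
  toFun γ := κ * ∫ h, f h * (coeff μ φ φ γ h : ℂ) ∂μ
  continuous_toFun := continuous_of_discreteTopology
  hasCompactSupport' := by
    obtain ⟨s, hs⟩ := exists_coeffSupport (Γ := Γ) φ φ f.hasCompactSupport
    refine HasCompactSupport.intro s.finite_toSet.isCompact fun γ hγ => ?_
    have : ∀ h, f h * (coeff μ φ φ γ h : ℂ) = 0 := fun h => by
      by_cases hh : h ∈ tsupport f
      · rw [hs.coeff_eq_zero hh hγ, Complex.ofReal_zero, mul_zero]
      · rw [image_eq_zero_of_notMem_tsupport hh, zero_mul]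
    simp [this]

lemma transfer_apply (φ : C_c(G, ℝ)) (κ : ℝ) (f : C_c(G, ℂ)) (γ : Γ) :
    transfer μ φ κ f γ = κ * ∫ h, f h * (coeff μ φ φ γ h : ℂ) ∂μ := rfl

lemma transfer_add (φ : C_c(G, ℝ)) (κ : ℝ) (f f' : C_c(G, ℂ)) :
    transfer (Γ := Γ) μ φ κ (f + f') = transfer μ φ κ f + transfer μ φ κ f' := by
  ext γ
  simp only [transfer_apply, CompactlySupportedContinuousMap.add_apply, add_mul]
  rw [integral_add (integrable_mul_coeff μ f φ φ γ) (integrable_mul_coeff μ f' φ φ γ), mul_add]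

lemma transfer_smul (φ : C_c(G, ℝ)) (κ : ℝ) (c : ℂ) (f : C_c(G, ℂ)) :
    transfer (Γ := Γ) μ φ κ (c • f) = c • transfer μ φ κ f := by
  ext γ
  simp only [transfer_apply, CompactlySupportedContinuousMap.smul_apply, smul_eq_mul, mul_assoc]
  rw [integral_const_mul, mul_left_comm]

lemma transfer_conj (φ : C_c(G, ℝ)) (κ : ℝ) (f : C_c(G, ℂ)) :
    transfer (Γ := Γ) μ φ κ (ccConj f) = ccConj (transfer μ φ κ f) := by
  ext γ
  change (κ : ℂ) * ∫ h, conj (f h) * (coeff μ φ φ γ h : ℂ) ∂μ =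
    conj ((κ : ℂ) * ∫ h, f h * (coeff μ φ φ γ h : ℂ) ∂μ)
  rw [map_mul, Complex.conj_ofReal, ← integral_conj]
  simp only [map_mul, Complex.conj_ofReal]

variable [MeasurableSpace (G ⧸ Γ)] [BorelSpace (G ⧸ Γ)] {ν : Measure (G ⧸ Γ)} [IsFiniteMeasure ν]
variable {μ}

lemma WeilFormula.transfer_star (hW : WeilFormula Γ μ ν) (φ : C_c(G, ℝ)) (κ : ℝ) (f : C_c(G, ℂ)) :
    transfer (Γ := Γ) μ φ κ (ccStar f) = ccStar (transfer μ φ κ f) := by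
  ext γ
  change (κ : ℂ) * ∫ h, ((Measure.modularCharacterFun h : ℝ) : ℂ) * conj (f h⁻¹) *
    (coeff μ φ φ γ h : ℂ) ∂μ = ((Measure.modularCharacterFun γ : ℝ) : ℂ) *
    conj ((κ : ℂ) * ∫ h, f h * (coeff μ φ φ γ⁻¹ h : ℂ) ∂μ)
  have hs : HasCompactSupport fun h : G => conj (f h⁻¹) * (coeff μ φ φ γ h : ℂ) :=
    ((f.hasCompactSupport.comp_homeomorph (Homeomorph.inv G)).comp_left
      (g := conj) (map_zero _)).mul_right
  have hc : Continuous fun h : G => conj (f h⁻¹) * (coeff μ φ φ γ h : ℂ) :=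
    (Complex.continuous_conj.comp (f.continuous.comp continuous_inv)).mul
      (Complex.continuous_ofReal.comp (continuous_coeff φ φ γ))
  have h1 := integral_inv_eq_modular μ hc hs
  simp only [inv_inv, Complex.real_smul, ← mul_assoc] at h1
  simp only [hW.coeff_inv φ φ γ] at h1
  rw [h1, modularCharacterFun_eq_one_of_discrete, map_mul, Complex.conj_ofReal, ← integral_conj]
  simp only [map_mul, Complex.conj_ofReal, NNReal.coe_one, Complex.ofReal_one, one_mul]

section Rep

variable {E : Type*} [NormedAddCommGroup E] [NormedSpace ℂ E] [CompleteSpace E]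
  (π : IsometricRep Γ E) [SMulInvariantMeasure G (G ⧸ Γ) ν]

lemma average_integrate (hW : WeilFormula Γ μ ν) (ψ : C_c(G, ℝ)) (f : C_c(G, ℂ))
    (x : IndSpace ν π) :
    average hW π ψ ((indRep ν π).integrate μ f x) =
      ∫ h, f h • average hW π ψ ((indRep ν π).toHom h x) ∂μ := by
  rw [IsometricRep.integrate_apply, ← ContinuousLinearMap.integral_comp_comm _
    ((indRep ν π).integrable μ f x)]
  simp only [map_smul]

lemma integrate_eq_sum_of_discrete {H : Type*} [Group H] [TopologicalSpace H]
    [IsTopologicalGroup H] [DiscreteTopology H] [MeasurableSpace H] [BorelSpace H]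
    (ρ : IsometricRep H E) (μH : Measure H) [μH.IsHaarMeasure] (f : C_c(H, ℂ)) (s : Finset H)
    (hs : ∀ h ∉ s, f h = 0) (v : E) :
    ρ.integrate μH f v = μH.real {1} • ∑ h ∈ s, f h • ρ.toHom h v := by
  rw [IsometricRep.integrate_apply, ← setIntegral_eq_integral_of_forall_compl_eq_zero (s := s)
    (fun h hh => by rw [hs h (by simpa using hh), zero_smul]),
    setIntegral_finset s (f := fun h => f h • ρ.toHom h v) (ρ.integrable μH f v).integrableOn,
    Finset.smul_sum]
  refine Finset.sum_congr rfl fun h _ => ?_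
  rw [measureReal_def, measureReal_def, Measure.haar_singleton]

/-- The transferred function acts in a representation of `Γ` as the compression of the function
acting in the induced representation. -/
lemma integrate_transfer (hW : WeilFormula Γ μ ν) (μΓ : Measure Γ) [μΓ.IsHaarMeasure]
    (φ : C_c(G, ℝ)) (κ : ℝ) (f : C_c(G, ℂ)) (v : E) :
    π.integrate μΓ (transfer μ φ κ f) v = (μΓ.real {1} * κ) •
      average hW π φ ((indRep ν π).integrate μ f (sectionMap ν π φ v)) := by
  obtain ⟨s, hs⟩ := exists_coeffSupport (Γ := Γ) φ φ f.hasCompactSupport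
  have h0 : ∀ γ ∉ s, ∀ h, f h * (coeff μ φ φ γ h : ℂ) = 0 := fun γ hγ h => by
    by_cases hh : h ∈ tsupport f
    · rw [hs.coeff_eq_zero hh hγ, Complex.ofReal_zero, mul_zero]
    · rw [image_eq_zero_of_notMem_tsupport hh, zero_mul]
  rw [integrate_eq_sum_of_discrete π μΓ _ s fun γ hγ => by
    simp [transfer_apply, h0 γ hγ], average_integrate, mul_smul]
  congr 1
  have hpt : ∀ h, f h • average hW π φ ((indRep ν π).toHom h (sectionMap ν π φ v)) =
      ∑ γ ∈ s, (f h * (coeff μ φ φ γ h : ℂ)) • π.toHom γ v := fun h => by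
    by_cases hh : h ∈ tsupport f
    · rw [hs.average_eq_sum hW hh, Finset.smul_sum]
      simp only [mul_smul, Complex.coe_smul]
    · simp [image_eq_zero_of_notMem_tsupport hh]
  simp only [hpt]
  rw [integral_finsetSum _ fun γ _ => (integrable_mul_coeff μ f φ φ γ).smul_const _,
    Finset.smul_sum]
  refine Finset.sum_congr rfl fun γ _ => ?_
  rw [integral_smul_const, transfer_apply, mul_smul, Complex.coe_smul]

/-- If the sums of `ψ` over `Γ` are `1` on the support of all translates which occur in `f`, then
averaging against `ψ` is integration over `G ⧸ Γ` of sections with invariant values. -/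
lemma average_integrate_sectionMap (hW : WeilFormula Γ μ ν) (ψ φ : C_c(G, ℝ)) (f : C_c(G, ℂ))
    (hψ : ∀ g ∈ tsupport f * tsupport φ, perTotal Γ ψ g = 1) {v : E} (hv : v ∈ π.invariants) :
    average hW π ψ ((indRep ν π).integrate μ f (sectionMap ν π φ v)) =
      (∫ h, f h ∂μ) • (∫ g, φ g ∂μ) • v := by
  classical
  obtain ⟨s, hs⟩ := exists_coeffSupport (Γ := Γ) ψ φ f.hasCompactSupport
  have hv' : ∀ γ, π.toHom γ v = v := hv
  have key : ∀ h ∈ tsupport f, ∑ γ ∈ s, coeff μ ψ φ γ h = ∫ g, φ g ∂μ := fun h hh => by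
    have h1 : ∀ γ : Γ, coeff μ ψ φ γ h = ∫ g, ψ (g * (γ⁻¹ : Γ)) * φ (h⁻¹ * g) ∂μ := fun γ => by
      have hc : Continuous fun g => ψ (g * (γ⁻¹ : Γ)) * φ (h⁻¹ * g) := by fun_prop
      have hcs : HasCompactSupport fun g => ψ (g * (γ⁻¹ : Γ)) * φ (h⁻¹ * g) :=
        (φ.hasCompactSupport.comp_homeomorph (Homeomorph.mulLeft h⁻¹)).mul_left
      rw [← hW.integral_mul_right hc hcs γ]
      simp [coeff, mul_assoc]
    have hi : ∀ γ : Γ, Integrable (fun g => ψ (g * (γ⁻¹ : Γ)) * φ (h⁻¹ * g)) μ := fun γ => by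
      have hc : Continuous fun g => ψ (g * (γ⁻¹ : Γ)) * φ (h⁻¹ * g) := by fun_prop
      exact hc.integrable_of_hasCompactSupport
        (φ.hasCompactSupport.comp_homeomorph (Homeomorph.mulLeft h⁻¹)).mul_left
    simp only [h1]
    rw [← integral_finsetSum _ fun γ _ => hi γ, ← integral_mul_left_eq_self (fun g => φ g) h⁻¹]
    congr 1 with g
    rw [← Finset.sum_mul]
    by_cases hg : φ (h⁻¹ * g) = 0
    · rw [hg, mul_zero]
    · have hmem : g ∈ tsupport f * tsupport φ := ⟨h, hh, h⁻¹ * g, subset_tsupport _ hg, by simp⟩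
      have h2 := hψ g hmem
      rw [perTotal, perSum_eq_sum ψ _ g (s.image fun γ => γ⁻¹)] at h2
      · rw [Finset.sum_image (fun _ _ _ _ h => inv_injective h)] at h2
        simp only [smul_eq_mul, mul_one] at h2
        rw [h2, one_mul]
      · intro γ hγ
        rw [Finset.mem_image]
        refine ⟨γ⁻¹, hs h hh (g * γ) (subset_tsupport _ hγ) γ⁻¹ ?_, inv_inv γ⟩
        simpa [mul_assoc] using hg
  rw [average_integrate, ← integral_smul_const]
  congr 1 with h
  by_cases hh : h ∈ tsupport f
  · rw [hs.average_eq_sum hW hh]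
    simp only [hv']
    rw [← Finset.sum_smul, key h hh]
  · simp [image_eq_zero_of_notMem_tsupport hh]

end Rep

end Transfer

/-! ### Transfer of the projection -/

section Projection

variable {G : Type u} [Group G] [TopologicalSpace G] [IsTopologicalGroup G]
  [LocallyCompactSpace G] [T2Space G] [MeasurableSpace G] [BorelSpace G] {Γ : Subgroup G}
  [DiscreteTopology Γ] [MeasurableSpace (G ⧸ Γ)] [BorelSpace (G ⧸ Γ)] {μ : Measure G}
  [μ.IsHaarMeasure] {ν : Measure (G ⧸ Γ)} [IsFiniteMeasure ν]
  [SMulInvariantMeasure G (G ⧸ Γ) ν] {𝓔 𝓕 : BanachClass.{max u v}}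

lemma norm_transfer_le (hW : WeilFormula Γ μ ν) (μΓ : Measure Γ) [μΓ.IsHaarMeasure]
    (hInd : ∀ (E : Type (max u v)) [NormedAddCommGroup E] [NormedSpace ℂ E] [CompleteSpace E],
      𝓔 E → ∀ π : IsometricRep Γ E, 𝓕 (IndSpace ν π)) (φ : C_c(G, ℝ)) (κ : ℝ) {C : ℝ}
    (hC : ∀ g, perTotal Γ (ccAbs φ) g ≤ C) (f : C_c(G, ℂ)) :
    ‖toCcAlg 𝓔 μΓ (transfer μ φ κ f)‖ ≤
      |μΓ.real {1} * κ| * (C * √(ν.real Set.univ)) ^ 2 * ‖toCcAlg 𝓕 μ f‖ := by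
  have hC0 : 0 ≤ C := (perTotal_nonneg (fun x => abs_nonneg (φ x)) 1).trans (hC 1)
  rw [norm_toCcAlg, norm_toCcAlg]
  have h0 := sSup_repNorms_nonneg 𝓕 μ f
  refine Real.sSup_le ?_ (by positivity)
  rintro _ ⟨E, _, _, _, hE, π, rfl⟩
  refine ContinuousLinearMap.opNorm_le_bound _ (by positivity) fun v => ?_
  rw [integrate_transfer π hW, norm_smul, Real.norm_eq_abs]
  have h1 := norm_average_le hW φ hC ((indRep ν π).integrate μ f (sectionMap ν π φ v))
  have h2 : ‖(indRep ν π).integrate μ f (sectionMap ν π φ v)‖ ≤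
      sSup (repNorms 𝓕 μ f) * (C * √(ν.real Set.univ) * ‖v‖) :=
    (((indRep ν π).integrate μ f).le_opNorm _).trans (mul_le_mul
      (norm_integrate_le_sSup 𝓕 μ (hInd E hE π) (indRep ν π) f)
      ((sectionMap ν π φ).le_of_opNorm_le (norm_sectionMap_le φ hC) v) (norm_nonneg _) h0)
  calc |μΓ.real {1} * κ| * ‖average hW π φ ((indRep ν π).integrate μ f (sectionMap ν π φ v))‖
      ≤ |μΓ.real {1} * κ| * (C * √(ν.real Set.univ) *
        (sSup (repNorms 𝓕 μ f) * (C * √(ν.real Set.univ) * ‖v‖))) := by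
        gcongr
        exact h1.trans (by gcongr)
    _ = _ := by ring

variable (𝓔 𝓕) in
/-- The transfer map is bounded from `C_c(G)` with the norm of a class `𝓕` to `C_c(Γ)` with the
norm of a class `𝓔`, if `𝓕` contains the spaces induced from spaces in `𝓔`. -/
noncomputable def transferL (hW : WeilFormula Γ μ ν) (μΓ : Measure Γ) [μΓ.IsHaarMeasure]
    (hInd : ∀ (E : Type (max u v)) [NormedAddCommGroup E] [NormedSpace ℂ E] [CompleteSpace E],
      𝓔 E → ∀ π : IsometricRep Γ E, 𝓕 (IndSpace ν π)) (φ : C_c(G, ℝ)) (κ : ℝ) :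
    CcAlg 𝓕 μ →L[ℂ] CcAlg 𝓔 μΓ :=
  LinearMap.mkContinuous
    { toFun := fun f : CcAlg 𝓕 μ => toCcAlg 𝓔 μΓ (transfer μ φ κ f)
      map_add' := transfer_add μ φ κ
      map_smul' := transfer_smul μ φ κ }
    (|μΓ.real {1} * κ| *
      ((exists_perTotal_le (Γ := Γ) (ccAbs φ)).choose * √(ν.real Set.univ)) ^ 2)
    (norm_transfer_le hW μΓ hInd φ κ (exists_perTotal_le (Γ := Γ) (ccAbs φ)).choose_spec)

variable {μΓ : Measure Γ} [μΓ.IsHaarMeasure] (hW : WeilFormula Γ μ ν)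
  (hInd : ∀ (E : Type (max u v)) [NormedAddCommGroup E] [NormedSpace ℂ E] [CompleteSpace E],
    𝓔 E → ∀ π : IsometricRep Γ E, 𝓕 (IndSpace ν π))

lemma completion_transferL_ofCc (φ : C_c(G, ℝ)) (κ : ℝ) (f : C_c(G, ℂ)) :
    (transferL 𝓔 𝓕 hW μΓ hInd φ κ).completion (ofCc 𝓕 μ f) =
      ofCc 𝓔 μΓ (transfer μ φ κ f) :=
  ContinuousLinearMap.completion_apply_coe (transferL 𝓔 𝓕 hW μΓ hInd φ κ) _

lemma isFixedByExtension_transfer {σ : C_c(G, ℂ) → C_c(G, ℂ)} {σ' : C_c(Γ, ℂ) → C_c(Γ, ℂ)}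
    (φ : C_c(G, ℝ)) (κ : ℝ) (hσ : ∀ f, transfer μ φ κ (σ f) = σ' (transfer μ φ κ f))
    {p : CAlg 𝓕 μ} (hp : IsFixedByExtension 𝓕 μ σ p) :
    IsFixedByExtension 𝓔 μΓ σ' ((transferL 𝓔 𝓕 hW μΓ hInd φ κ).completion p) := by
  have hc := (transferL 𝓔 𝓕 hW μΓ hInd φ κ).completion.continuous
  let τ := (transferL 𝓔 𝓕 hW μΓ hInd φ κ).completion
  refine map_mem_closure (f := Prod.map τ τ) (hc.prodMap hc) hp ?_
  rintro _ ⟨f, rfl⟩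
  refine ⟨transfer μ φ κ f, ?_⟩
  rw [Prod.map_apply]
  simp only [τ]
  rw [completion_transferL_ofCc, completion_transferL_ofCc, hσ]

lemma repOp_transfer {E : Type (max u v)} [NormedAddCommGroup E] [NormedSpace ℂ E]
    [CompleteSpace E] (hE : 𝓔 E) (π : IsometricRep Γ E) (φ : C_c(G, ℝ)) (κ : ℝ)
    (a : CAlg 𝓕 μ) (v : E) :
    repOp μΓ hE π ((transferL 𝓔 𝓕 hW μΓ hInd φ κ).completion a) v = (μΓ.real {1} * κ) •
      average hW π φ (repOp μ (hInd E hE π) (indRep ν π) a (sectionMap ν π φ v)) := by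
  induction a using induction_ofCc with
  | hc =>
    refine isClosed_eq ?_ ?_
    · exact ((repOp μΓ hE π).continuous.comp
        (transferL 𝓔 𝓕 hW μΓ hInd φ κ).completion.continuous).clm_apply continuous_const
    · exact ((average hW π φ).continuous.comp ((repOp μ (hInd E hE π)
        (indRep ν π)).continuous.clm_apply continuous_const)).const_smul _
  | h f =>
    rw [completion_transferL_ofCc, repOp_ofCc, repOp_ofCc, integrate_transfer π hW]

/-- The projection of the group sends the section attached to an invariant vector `v` to the
constant section with the same integral over `G ⧸ Γ`. -/
lemma vol_smul_eq_integral_smul [ν.Regular] {E : Type (max u v)} [NormedAddCommGroup E]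
    [NormedSpace ℂ E] [CompleteSpace E] (π : IsometricRep Γ E) (hE : 𝓕 E)
    (hI : 𝓕 (IndSpace ν π)) {p : CAlg 𝓕 μ} (hp : IsIdempotentElem p)
    (hrange : ∀ (E : Type (max u v)) [NormedAddCommGroup E] [NormedSpace ℂ E] [CompleteSpace E]
      (hE : 𝓕 E) (ρ : IsometricRep G E), Set.range (repOp μ hE ρ p) = ρ.invariants)
    (φ : C_c(G, ℝ)) {v w : E} (hv : v ∈ π.invariants)
    (hw : ∀ ψ, average hW π ψ (repOp μ hI (indRep ν π) p (sectionMap ν π φ v)) =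
      (∫ g, ψ g ∂μ) • w) :
    ν.real Set.univ • w = (∫ g, φ g ∂μ) • v := by
  -- `p` acts as the identity in the trivial representation on `E`
  have htriv : repOp μ hE (trivialRep G E) p v = v := by
    obtain ⟨z, hz⟩ : v ∈ Set.range (repOp μ hE (trivialRep G E) p) := by
      rw [hrange]
      exact fun _ => rfl
    have h1 := repOp_mul hE (trivialRep G E) p p
    rw [hp.eq] at h1
    rw [← hz]
    exact (congrArg (fun L => L z) h1).symm
  set V := ν.real Set.univ with hV
  set m := ∫ g, φ g ∂μ with hm
  set S := sectionMap ν π φ v with hS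
  have hV0 : 0 ≤ V := measureReal_nonneg
  have key : ∀ e > 0, ‖V • w - m • v‖ ≤ e * (‖w‖ + √V * ‖S‖ + |m| * ‖v‖) := by
    intro e he
    obtain ⟨f, hf⟩ := exists_norm_sub_ofCc_lt p he
    set b := ∫ h, f h ∂μ with hb
    have h1 : ‖v - b • v‖ ≤ e * ‖v‖ := by
      have h2 := (repOp μ hE (trivialRep G E) (p - ofCc 𝓕 μ f)).le_of_opNorm_le
        ((norm_repOp_le hE (trivialRep G E) _).trans hf.le) v
      rw [map_sub, repOp_ofCc, sub_apply, htriv, IsometricRep.integrate_apply] at h2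
      have h3 : ∫ g, f g • (trivialRep G E).toHom g v ∂μ = b • v := integral_smul_const _ _
      rwa [h3] at h2
    obtain ⟨K, hK, hKu⟩ : ∃ K : Set G, IsCompact K ∧ ∀ u : G → ℝ, Continuous u →
        (∀ (g : G) (γ : Γ), u (g * γ) = u g) → (∀ g, 0 ≤ u g) → (∀ g, u g ≤ 1) →
        (∀ g ∈ K, u g = 1) → |V - ∫ x : G ⧸ Γ, u x.out ∂ν| ≤ e := by
      rcases hV0.eq_or_lt with h0 | h0
      · refine ⟨∅, isCompact_empty, fun u _ _ _ _ _ => ?_⟩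
        have hν : ν = 0 := by
          rwa [hV, eq_comm, measureReal_def, ENNReal.toReal_eq_zero_iff,
            Measure.measure_univ_eq_zero, or_iff_left (measure_ne_top ν _)] at h0
        rw [← h0]
        simp [hν, he.le]
      · obtain ⟨K, hK, h⟩ := exists_isCompact_integral_ge ν (r := max (V - e) 0)
          (le_max_right _ _) (max_lt (by linarith) h0)
        refine ⟨K, hK, fun u a1 a2 a3 a4 a5 => ?_⟩
        obtain ⟨h2, h3⟩ := h u a1 a2 a3 a4 a5
        have h4 := (le_max_left _ _).trans h2
        rw [abs_le]
        constructor <;> linarith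
    -- `ψ` sums to `1` both on a set of almost full measure and where the translates of the
    -- section by the support of `f` live
    obtain ⟨ψ, hψ0, hψ1, hψK⟩ := exists_perTotal_eq_one Γ
      (hK.union (f.hasCompactSupport.isCompact.mul φ.hasCompactSupport.isCompact))
    have hψV : |V - ∫ g, ψ g ∂μ| ≤ e := by
      rw [hW ψ]
      exact hKu _ (continuous_perSum ψ _) (perTotal_mul_right ψ) (perTotal_nonneg hψ0) hψ1
        fun g hg => hψK g (Or.inl hg)
    have hψabs : ccAbs ψ = ψ := by
      ext x
      exact abs_of_nonneg (hψ0 x)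
    have h5 : ‖(∫ g, ψ g ∂μ) • w - b • m • v‖ ≤ √V * (e * ‖S‖) := by
      rw [← hw ψ, ← average_integrate_sectionMap π hW ψ φ f (fun g hg => hψK g (Or.inr hg)) hv,
        ← map_sub, ← repOp_ofCc μ hI (indRep ν π) f, ← sub_apply, ← map_sub]
      refine (norm_average_le hW ψ (C := 1) (by rwa [hψabs]) _).trans ?_
      rw [one_mul]
      gcongr
      exact (repOp μ hI (indRep ν π) (p - ofCc 𝓕 μ f)).le_of_opNorm_le
        ((norm_repOp_le hI (indRep ν π) _).trans hf.le) _
    have h6 : V • w - m • v = (V - ∫ g, ψ g ∂μ) • w + ((∫ g, ψ g ∂μ) • w - b • m • v) -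
        m • (v - b • v) := by
      rw [sub_smul, smul_sub, smul_comm b m v]
      abel
    rw [h6]
    refine (norm_sub_le _ _).trans ((add_le_add (norm_add_le _ _) le_rfl).trans ?_)
    rw [norm_smul, norm_smul, Real.norm_eq_abs, Real.norm_eq_abs]
    have h7 : |V - ∫ g, ψ g ∂μ| * ‖w‖ ≤ e * ‖w‖ := by gcongr
    have h8 : |m| * ‖v - b • v‖ ≤ |m| * (e * ‖v‖) := by gcongr
    nlinarith
  have hle : ‖V • w - m • v‖ ≤ 0 := by
    set A := ‖w‖ + √V * ‖S‖ + |m| * ‖v‖ with hA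
    have hA0 : 0 ≤ A := by positivity
    refine le_of_forall_pos_le_add fun e he => ?_
    refine (key (e / (A + 1)) (by positivity)).trans ?_
    rw [zero_add, div_mul_eq_mul_div, div_le_iff₀ (by positivity)]
    nlinarith
  exact sub_eq_zero.1 (norm_le_zero_iff.1 hle)

end Projection

end BanachT

theorem proposition5p6 (G : Type u) [Group G] [TopologicalSpace G] [IsTopologicalGroup G]
    [LocallyCompactSpace G] [T2Space G] [MeasurableSpace G] [BorelSpace G]
    (Γ : Subgroup G) [DiscreteTopology Γ] (hΓ : BanachT.HasFiniteCovolume Γ)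
    (hG : BanachT.BanachPropertyT.{u, max u v} G) : BanachT.BanachPropertyT.{u, max u v} Γ := by
  open BanachT in
  let _ : MeasurableSpace (G ⧸ Γ) := borel (G ⧸ Γ)
  have : BorelSpace (G ⧸ Γ) := ⟨rfl⟩
  obtain ⟨ν, hν0, _, _, _⟩ := hΓ
  obtain ⟨μ, _, hW⟩ := exists_haar_integral_eq ν hν0
  replace hW : WeilFormula Γ μ ν := hW
  intro 𝓔 hE1 hE2 hE3 μΓ _
  -- `q` is the transfer of the projection `a` which (T) provides for the class `typeClass p T`
  obtain ⟨p, T, hp1, hp2, hT, hclass⟩ := hE1.exists_typeClass hE2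
  have hInd : ∀ (E : Type (max u v)) [NormedAddCommGroup E] [NormedSpace ℂ E] [CompleteSpace E],
      𝓔 E → ∀ π : IsometricRep Γ E, typeClass.{max u v} p T (IndSpace ν π) :=
    fun E _ _ _ hE π => typeClass_indSpace hp1.le hp2 hT (hclass E hE)
  obtain ⟨a, ha, hreal, hself, hrange⟩ := hG (typeClass p T) (typeClass_isOfTypeGTOne hp1 hT)
    (typeClass_isStableUnderDuality (by linarith) hT) typeClass_isStableUnderConj μ
  obtain ⟨φ, hφs, hφ0, hφ1⟩ : ∃ f : C(G, ℝ), HasCompactSupport f ∧ 0 ≤ f ∧ f 1 ≠ 0 :=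
    exists_continuous_nonneg_pos 1
  have hm : 0 < ∫ g, φ g ∂μ :=
    φ.continuous.integral_pos_of_hasCompactSupport_nonneg_nonzero hφs hφ0 hφ1
  let φc : C_c(G, ℝ) := ⟨φ, hφs⟩
  replace hm : 0 < ∫ g, φc g ∂μ := hm
  set m := ∫ g, φc g ∂μ with hmdef
  have hV : 0 < ν.real Set.univ := by
    have := NeZero.mk hν0
    exact measureReal_univ_pos
  have hc : 0 < μΓ.real {1} := by
    refine ENNReal.toReal_pos ?_ ?_
    · exact ((isOpen_discrete _).measure_pos _ (Set.singleton_nonempty _)).ne'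
    · exact isCompact_singleton.measure_ne_top
  -- the factor `μΓ {1}` is the mass of a point and each of the two maps between `E` and the
  -- induced space contributes a factor `m`;
  -- with this constant the transferred projection fixes invariant vectors
  set κ : ℝ := ν.real Set.univ / (μΓ.real {1} * m ^ 2) with hκ
  let q : CAlg 𝓔 μΓ := (transferL 𝓔 (typeClass p T) hW μΓ hInd φc κ).completion a
  have hq : ∀ (E : Type (max u v)) [NormedAddCommGroup E] [NormedSpace ℂ E] [CompleteSpace E]
      (hE : 𝓔 E) (π : IsometricRep Γ E) (v : E), repOp μΓ hE π q v ∈ π.invariants ∧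
        (v ∈ π.invariants → repOp μΓ hE π q v = v) := by
    intro E _ _ _ hE π v
    have hx : repOp μ (hInd E hE π) (indRep ν π) a (sectionMap ν π φc v) ∈
        (indRep ν π).invariants := by
      rw [← hrange _ (hInd E hE π) (indRep ν π)]
      exact ⟨_, rfl⟩
    obtain ⟨w, hw1, hw2⟩ := exists_average_eq_smul hW hx
    have hqv : repOp μΓ hE π q v = (μΓ.real {1} * κ) • m • w := by
      rw [repOp_transfer hW hInd hE π φc κ a v, hw2 φc]
    refine ⟨fun γ => ?_, fun hv => ?_⟩
    · rw [hqv, (π.toHom γ).map_smul_of_tower, (π.toHom γ).map_smul_of_tower, hw1 γ]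
    · have h1 := vol_smul_eq_integral_smul hW π (hclass E hE) (hInd E hE π) ha hrange φc hv hw2
      have h2 : μΓ.real {1} * κ * m = m⁻¹ * ν.real Set.univ := by
        rw [hκ]
        field_simp
      rw [hqv, smul_smul, h2, mul_smul, h1, ← hmdef, inv_smul_smul₀ hm.ne']
  refine ⟨q, ?_, ?_, ?_, fun E _ _ _ hE π => ?_⟩
  · refine eq_of_repOp_eq fun E _ _ _ hE π => ?_
    ext v
    rw [repOp_mul]
    exact (hq E hE π _).2 (hq E hE π v).1
  · exact isFixedByExtension_transfer hW hInd φc κ (transfer_conj μ φc κ) hreal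
  · exact isFixedByExtension_transfer hW hInd φc κ (hW.transfer_star φc κ) hself
  · refine Set.Subset.antisymm ?_ fun v hv => ⟨v, (hq E hE π v).2 hv⟩
    rintro _ ⟨v, rfl⟩
    exact (hq E hE π v).1
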